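/- Let $Q\subset\mathbb R^d$ be the input space, let $f_1:Q\to\mathbb R^{p_1}$ and $f_2:Q\to\mathbb R^{p_2}$ be regression functions, and let $r_1,r_2:\mathbb R^d\to\mathbb R$ be correlation functions (in particular $r_1(0)=r_2(0)=1$). Let $D_t=\{x^{(t)}_1,\dots,x^{(t)}_{n_t}\}\subset Q$ ($t=1,2$) be designs with $D_2\subseteq D_1$. Let $\rho\in\mathbb R$, $\sigma_1^2,\sigma_2^2>0$ and $\beta_2\in\mathbb R^{p_2}$ be known. Given $\beta_1\in\mathbb R^{p_1}$, let $(Z_1(x))_{x\in Q}$ and $(\delta(x))_{x\in Q}$ be independent Gaussian processes with means $f_1(x)^T\beta_1$, $f_2(x)^T\beta_2$ and covariance functions $\sigma_1^2r_1(x-x')$, $\sigma_2^2r_2(x-x')$ respectively (the law of $\delta$ does not depend on $\beta_1$), and put $Z_2(x)=\rho Z_1(x)+\delta(x)$. The observed vector is $\mathcal Z=(Z_1(x^{(1)}_1),\dots,Z_1(x^{(1)}_{n_1}),Z_2(x^{(2)}_1),\dots,Z_2(x^{(2)}_{n_2}))^T$, with value $z=(z_1^T,z_2^T)^T$. Write $R_t(D,D')$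 for the matrix with entries $r_t(x-x')$, $x\in D$, $x'\in D'$, and $R_t(D)=R_t(D,D)$; write $F_t(D)$ for the matrix with rows $f_t(x)^T$, $x\in D$, and $F_1=F_1(D_1)$. Let $$H=\begin{pmatrix}F_1(D_1)&0\\ \rho F_1(D_2)&F_2(D_2)\end{pmatrix},\qquad V=\begin{pmatrix}\sigma_1^2R_1(D_1)&\rho\sigma_1^2R_1(D_1,D_2)\\ \rho\sigma_1^2R_1(D_2,D_1)&\rho^2\sigma_1^2R_1(D_2)+\sigma_2^2R_2(D_2)\end{pmatrix},$$ $$h'(x)^T=(\rho f_1(x)^T,f_2(x)^T),\qquad t(x)^T=\big(\rho\sigma_1^2R_1(\{x\},D_1),\ \rho^2\sigma_1^2R_1(\{x\},D_2)+\sigma_2^2R_2(\{x\},D_2)\big).$$ For $\beta=(\beta_1^T,\beta_2^T)^T$ the kriging mean and variance are $$m_{Z_2}(x;\beta_1,z)=h'(x)^T\beta+t(x)^TV^{-1}(z-H\beta),\qquad s^2_{Z_2}(x)=\rho^2\sigma_1^2+\sigma_2^2-t(x)^TV^{-1}t(x).$$ Consider one of two priors for $\beta_1$: (I) $\beta_1\sim\mathcal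 N(b_1,\sigma_1^2V_1)$ with $b_1\in\mathbb R^{p_1}$ and $V_1$ diagonal with positive diagonal entries; (II) the improper flat prior $p(\beta_1)\propto1$. Put $$A_{\rm I}^1=\Big[F_1^T\tfrac{R_1(D_1)^{-1}}{\sigma_1^2}F_1+\tfrac{V_1^{-1}}{\sigma_1^2}\Big]^{-1},\quad \nu_{\rm I}^1=F_1^T\tfrac{R_1(D_1)^{-1}}{\sigma_1^2}z_1+\tfrac{V_1^{-1}}{\sigma_1^2}b_1,\qquad A_{\rm II}^1=\Big[F_1^T\tfrac{R_1(D_1)^{-1}}{\sigma_1^2}F_1\Big]^{-1},\quad \nu_{\rm II}^1=F_1^T\tfrac{R_1(D_1)^{-1}}{\sigma_1^2}z_1 .$$ Assume that $R_1(D_1)$ and $R_2(D_2)$ are invertible and, in case (II), that $F_1^TR_1(D_1)^{-1}F_1$ is invertible. Let $x\in Q$ and, for $i\in\{{\rm I},{\rm II}\}$, $$\mu_i(x)=m_{Z_2}(x;A_i^1\nu_i^1,z),\qquad \sigma_i^2(x)=s^2_{Z_2}(x)+k_1A_i^1k_1^T,$$ where $k_1$ consists of the first $p_1$ entries of the row vector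 $k=h'(x)^T-t(x)^TV^{-1}H$. Then $V$ is invertible, $A_i^1$ is positive definite, $s^2_{Z_2}(x)\ge0$, $\sigma_i^2(x)\ge0$, and: 1. the posterior law of $\beta_1$ given $\mathcal Z=z$ is $\mathcal N(A_i^1\nu_i^1,A_i^1)$; 2. for every $\beta_1$, the law of $Z_2(x)$ given $\mathcal Z=z$ and $\beta_1$ is $\mathcal N(m_{Z_2}(x;\beta_1,z),s^2_{Z_2}(x))$; 3. for every $z$, integrating the law in 2 over $\beta_1$ with respect to the posterior law in 1 gives $\mathcal N(\mu_i(x),\sigma_i^2(x))$; 4. the predictive distribution, with $\beta_2,\rho,\sigma_1^2,\sigma_2^2$ known, is $$[Z_2(x)\mid\mathcal Z=z]\sim\mathcal N(\mu_i(x),\sigma_i^2(x)).$$ Here a Gaussian law with variance $0$ is a Dirac mass. Conditional laws are regular conditional distributions, i.e. disintegrations of the joint law of the quantity of interest and $\mathcal Z$ with respect to the law of $\mathcal Z$; in 1 and 4 this is taken under the joint measure "prior of $\beta_1$ times model given $\beta_1$", and in case (II), where that measure is infinite, the marginal law of $\mathcal Z$ is $\sigma$-finite. -/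

import Mathlib

open MeasureTheory ProbabilityTheory Matrix

namespace CoKriging

/-- `κ` is a (regular) conditional law of `X` given `Y` under the measure `M`: the law of `Y` is
σ-finite, `y ↦ κ y` is a Markov kernel, and the law of `(Y, X)` disintegrates as `law(Y) ⊗ κ`.
If `M` is a probability measure this is the usual conditional distribution `[X | Y = y]`; for an
infinite `M` (arising from an improper prior) it is the usual extension of that notion. -/
def IsCondLaw {Ω E F : Type*} [MeasurableSpace Ω] [MeasurableSpace E] [MeasurableSpace F]
    (M : Measure Ω) (X : Ω → F) (Y : Ω → E) (κ : E → Measure F) : Prop :=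
  SigmaFinite (M.map Y) ∧
    ∃ K : Kernel E F, IsMarkovKernel K ∧ (∀ y, K y = κ y) ∧
      M.map (fun ω => (Y ω, X ω)) = (M.map Y) ⊗ₘ K

/-- The known quantities of a two-level co-kriging model (the vector `β₁` is not among them). -/
structure Setup (d n₁ n₂ p₁ p₂ : ℕ) where
  /-- input space -/
  Q : Set (EuclideanSpace ℝ (Fin d))
  /-- regression functions of the cheap code -/
  f₁ : Q → Fin p₁ → ℝ
  /-- regression functions of the discrepancy process -/
  f₂ : Q → Fin p₂ → ℝ
  /-- correlation functions -/
  r₁ : EuclideanSpace ℝ (Fin d) → ℝ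
  r₂ : EuclideanSpace ℝ (Fin d) → ℝ
  r₁_zero : r₁ 0 = 1
  r₂_zero : r₂ 0 = 1
  /-- experimental designs, with the expensive one contained in the cheap one -/
  D₁ : Fin n₁ → Q
  D₂ : Fin n₂ → Q
  nested : Set.range D₂ ⊆ Set.range D₁
  /-- scale factor, standard deviations, regression coefficients of the discrepancy -/
  ρ : ℝ
  σ₁ : ℝ
  σ₂ : ℝ
  σ₁_pos : 0 < σ₁
  σ₂_pos : 0 < σ₂
  β₂ : Fin p₂ → ℝ

/-- The prior of `β₁` given `σ₁²`: (I) Gaussian with mean `b` and covariance `σ₁² diag(v)`,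
or (II) the non-informative (flat, improper) one. -/
inductive Prior (p : ℕ) where
  | informative (b v : Fin p → ℝ) (hv : ∀ i, 0 < v i)
  | nonInformative

variable {d n₁ n₂ p₁ p₂ : ℕ}

/-- Correlation matrix between two finite families of points. -/
def corrMatrix {Q : Set (EuclideanSpace ℝ (Fin d))} {m n : ℕ} (r : EuclideanSpace ℝ (Fin d) → ℝ)
    (D : Fin m → Q) (D' : Fin n → Q) : Matrix (Fin m) (Fin n) ℝ :=
  Matrix.of fun i j => r ((D i : EuclideanSpace ℝ (Fin d)) - D' j)

/-- Design matrix `F(D)`, whose rows are `f(x)ᵀ` for `x` in `D`. -/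
def designMatrix {Q : Set (EuclideanSpace ℝ (Fin d))} {m p : ℕ} (f : Q → Fin p → ℝ)
    (D : Fin m → Q) : Matrix (Fin m) (Fin p) ℝ :=
  Matrix.of fun i j => f (D i) j

namespace Setup

variable (S : Setup d n₁ n₂ p₁ p₂)

/-- `R₁(D₁)`. -/
def R₁ : Matrix (Fin n₁) (Fin n₁) ℝ := corrMatrix S.r₁ S.D₁ S.D₁

/-- `R₂(D₂)`. -/
def R₂ : Matrix (Fin n₂) (Fin n₂) ℝ := corrMatrix S.r₂ S.D₂ S.D₂

/-- `F₁ = F₁(D₁)`. -/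
def F₁ : Matrix (Fin n₁) (Fin p₁) ℝ := designMatrix S.f₁ S.D₁

/-- The matrix `H` with `E[𝒵] = H β`. -/
def H : Matrix (Fin n₁ ⊕ Fin n₂) (Fin p₁ ⊕ Fin p₂) ℝ :=
  Matrix.fromBlocks S.F₁ 0 (S.ρ • designMatrix S.f₁ S.D₂) (designMatrix S.f₂ S.D₂)

/-- The covariance matrix `V` of the observations. -/
def V : Matrix (Fin n₁ ⊕ Fin n₂) (Fin n₁ ⊕ Fin n₂) ℝ :=
  Matrix.fromBlocks
    (S.σ₁ ^ 2 • S.R₁)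
    ((S.ρ * S.σ₁ ^ 2) • corrMatrix S.r₁ S.D₁ S.D₂)
    ((S.ρ * S.σ₁ ^ 2) • corrMatrix S.r₁ S.D₂ S.D₁)
    ((S.ρ ^ 2 * S.σ₁ ^ 2) • corrMatrix S.r₁ S.D₂ S.D₂ + S.σ₂ ^ 2 • S.R₂)

/-- `h'(x)ᵀ = (ρ f₁(x)ᵀ, f₂(x)ᵀ)`. -/
def h (x : S.Q) : Fin p₁ ⊕ Fin p₂ → ℝ := Sum.elim (S.ρ • S.f₁ x) (S.f₂ x)

/-- `t(x)ᵀ = Cov(Z₂(x), 𝒵)`. -/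
def t (x : S.Q) : Fin n₁ ⊕ Fin n₂ → ℝ :=
  Sum.elim
    (fun j => S.ρ * S.σ₁ ^ 2 * S.r₁ ((x : EuclideanSpace ℝ (Fin d)) - S.D₁ j))
    (fun j => S.ρ ^ 2 * S.σ₁ ^ 2 * S.r₁ ((x : EuclideanSpace ℝ (Fin d)) - S.D₂ j)
      + S.σ₂ ^ 2 * S.r₂ ((x : EuclideanSpace ℝ (Fin d)) - S.D₂ j))

/-- The kriging mean `m_{Z₂}(x)` for given `β₁` and data `z`. -/
noncomputable def krigingMean (x : S.Q) (β₁ : Fin p₁ → ℝ) (z : Fin n₁ ⊕ Fin n₂ → ℝ) : ℝ :=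
  S.h x ⬝ᵥ Sum.elim β₁ S.β₂ + S.t x ⬝ᵥ (S.V⁻¹ *ᵥ (z - S.H *ᵥ Sum.elim β₁ S.β₂))

/-- The kriging variance `s²_{Z₂}(x)`. -/
noncomputable def krigingVar (x : S.Q) : ℝ :=
  S.ρ ^ 2 * S.σ₁ ^ 2 + S.σ₂ ^ 2 - S.t x ⬝ᵥ (S.V⁻¹ *ᵥ S.t x)

/-- `k = h'(x)ᵀ - t(x)ᵀ V⁻¹ H`. -/
noncomputable def k (x : S.Q) : Fin p₁ ⊕ Fin p₂ → ℝ := S.h x - S.t x ᵥ* (S.V⁻¹ * S.H)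

/-- The first `p₁` entries of `k`. -/
noncomputable def k₁ (x : S.Q) : Fin p₁ → ℝ := fun i => S.k x (Sum.inl i)

/-- The prior measure of `β₁`. -/
noncomputable def priorMeasure : Prior p₁ → Measure (EuclideanSpace ℝ (Fin p₁))
  | .informative b v _ => multivariateGaussian (WithLp.toLp 2 b) (S.σ₁ ^ 2 • Matrix.diagonal v)
  | .nonInformative => volume

/-- `A_i^1`. -/
noncomputable def A : Prior p₁ → Matrix (Fin p₁) (Fin p₁) ℝ
  | .informative _ v _ =>
      (S.F₁ᵀ * ((S.σ₁ ^ 2)⁻¹ • S.R₁⁻¹) * S.F₁ + (S.σ₁ ^ 2)⁻¹ • (Matrix.diagonal v)⁻¹)⁻¹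
  | .nonInformative => (S.F₁ᵀ * ((S.σ₁ ^ 2)⁻¹ • S.R₁⁻¹) * S.F₁)⁻¹

/-- `ν_i^1`, as a function of the cheap observations `z₁`. -/
noncomputable def ν (z₁ : Fin n₁ → ℝ) : Prior p₁ → Fin p₁ → ℝ
  | .informative b v _ =>
      (S.F₁ᵀ * ((S.σ₁ ^ 2)⁻¹ • S.R₁⁻¹)) *ᵥ z₁ + ((S.σ₁ ^ 2)⁻¹ • (Matrix.diagonal v)⁻¹) *ᵥ b
  | .nonInformative => (S.F₁ᵀ * ((S.σ₁ ^ 2)⁻¹ • S.R₁⁻¹)) *ᵥ z₁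

/-- `A_i^1 ν_i^1`, as a function of the data `z = (z₁, z₂)`. -/
noncomputable def postMean (π : Prior p₁) (z : Fin n₁ ⊕ Fin n₂ → ℝ) : Fin p₁ → ℝ :=
  S.A π *ᵥ S.ν (fun i => z (Sum.inl i)) π

/-- `μ_i(x)`: the kriging mean at `β₁ = A_i^1 ν_i^1`. -/
noncomputable def predMean (π : Prior p₁) (x : S.Q) (z : Fin n₁ ⊕ Fin n₂ → ℝ) : ℝ :=
  S.krigingMean x (S.postMean π z) z

/-- `σ²_i(x) = s²_{Z₂}(x) + k₁ A_i^1 k₁ᵀ`. -/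
noncomputable def predVar (π : Prior p₁) (x : S.Q) : ℝ :=
  S.krigingVar x + S.k₁ x ⬝ᵥ (S.A π *ᵥ S.k₁ x)

/-- The two-level model. `P β₁` is the probability given `β₁` (and the known parameters): under it
`Z₁` and `δ` are independent Gaussian processes with the prescribed means and covariances. -/
structure IsModel {Ω : Type*} [MeasurableSpace Ω] (Z₁ δ : S.Q → Ω → ℝ)
    (P : Kernel (EuclideanSpace ℝ (Fin p₁)) Ω) : Prop where
  measurable_Z₁ : ∀ x, Measurable (Z₁ x)
  measurable_δ : ∀ x, Measurable (δ x)
  gaussian_Z₁ : ∀ β₁, IsGaussianProcess Z₁ (P β₁)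
  gaussian_δ : ∀ β₁, IsGaussianProcess δ (P β₁)
  indep : ∀ β₁, IndepFun (fun ω x => Z₁ x ω) (fun ω x => δ x ω) (P β₁)
  mean_Z₁ : ∀ β₁ x, ∫ ω, Z₁ x ω ∂(P β₁) = S.f₁ x ⬝ᵥ β₁.ofLp
  mean_δ : ∀ β₁ x, ∫ ω, δ x ω ∂(P β₁) = S.f₂ x ⬝ᵥ S.β₂
  cov_Z₁ : ∀ β₁ x y, cov[Z₁ x, Z₁ y; P β₁] =
    S.σ₁ ^ 2 * S.r₁ ((x : EuclideanSpace ℝ (Fin d)) - y)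
  cov_δ : ∀ β₁ x y, cov[δ x, δ y; P β₁] =
    S.σ₂ ^ 2 * S.r₂ ((x : EuclideanSpace ℝ (Fin d)) - y)

/-- The expensive code `Z₂(x) = ρ Z₁(x) + δ(x)`. -/
def Z₂ {Ω : Type*} (Z₁ δ : S.Q → Ω → ℝ) (x : S.Q) (ω : Ω) : ℝ := S.ρ * Z₁ x ω + δ x ω

/-- The observed vector `𝒵 = (Z₁(D₁), Z₂(D₂))`. -/
def obs {Ω : Type*} (Z₁ δ : S.Q → Ω → ℝ) (ω : Ω) : Fin n₁ ⊕ Fin n₂ → ℝ :=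
  Sum.elim (fun i => Z₁ (S.D₁ i) ω) (fun j => S.Z₂ Z₁ δ (S.D₂ j) ω)

end Setup

end CoKriging

/-! Everything reduces to a residual criterion: if the pair `(Y, X - g Y)` has a product law `l ⊗ τ`
with `τ` a probability, then `X` given `Y = y` has the law `τ` translated by `g y`. No densities
occur, so singular Gaussian laws need no separate case, and `l` may be infinite, which covers the
improper prior (`isCondLaw_of_map_residual_eq_prod`).

Given `β₁`, the data are `H₁ β₁ + offset + e` with `e` centred Gaussian of covariance `V`. The usual
posterior precision is `H₁ᵀ V⁻¹ H₁` plus the prior precision. Because the designs are nested, `H₁ᵀ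
V⁻¹ = (F₁ᵀ R₁⁻¹ / σ₁², 0)`: with `ρ` and `β₂` known, the expensive observations bring no information
on `β₁` (`scoreMatrix_mul_V`). This is why `A` and `ν` involve the cheap level only. Invertibility
of `V` also comes from nesting, the Schur complement being `σ₂² R₂`.

With a Gaussian prior, the posterior residual and the data are jointly Gaussian and uncorrelated,
hence independent (`map_residual_gaussian_prior`). With the flat prior, translation invariance of
Lebesgue measure replaces this argument (`map_residual_flat_prior`). For known `β₁`, the law of `Z₂
x` given the data is Gaussian conditioning (`isCondLaw_kriging`). Its mean is affine in `β₁` with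
slope `k₁` and its variance is free of `β₁`, so integrating over the posterior is a convolution of
Gaussians, adding `k₁ A k₁ᵀ` to the variance. The tower property, `isCondLaw_predictive`, identifies
the result as the predictive law. -/

namespace CoKriging

/-! ### Conditional laws as disintegrations. -/

section Disintegration

variable {Ω B E F : Type*} [MeasurableSpace Ω] [MeasurableSpace B] [MeasurableSpace E]
  [MeasurableSpace F]

/-- The kernel sending `y` to the translate of `τ` by `g y`. -/
noncomputable def translationKernel [Add F] (τ : Measure F) (g : E → F) : Kernel E F :=
  (Kernel.id ×ₖ Kernel.const E τ).map (fun p => g p.1 + p.2)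

lemma translationKernel_apply [Add F] [MeasurableAdd₂ F] (τ : Measure F) [SFinite τ] {g : E → F}
    (hg : Measurable g) (y : E) : translationKernel τ g y = τ.map (fun x => g y + x) := by
  have h2 : Measurable fun p : E × F => g p.1 + p.2 := (hg.comp measurable_fst).add measurable_snd
  rw [translationKernel, Kernel.map_apply _ h2, Kernel.prod_apply, Kernel.id_apply,
    Kernel.const_apply, Measure.dirac_prod, Measure.map_map h2 measurable_prodMk_left]
  rfl

lemma isMarkovKernel_translationKernel [Add F] [MeasurableAdd₂ F] (τ : Measure F)
    [IsProbabilityMeasure τ] {g : E → F} (hg : Measurable g) :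
    IsMarkovKernel (translationKernel τ g) :=
  Kernel.IsMarkovKernel.map _ ((hg.comp measurable_fst).add measurable_snd)

/-- If the residual `X - g Y` is independent of `Y`, in the sense that the joint law is a product,
then the conditional law of `X` given `Y = y` is the law of the residual translated by `g y`. -/
theorem isCondLaw_of_map_residual_eq_prod [AddCommGroup F] [MeasurableAdd₂ F] [MeasurableSub₂ F]
    {M : Measure Ω} {X : Ω → F} {Y : Ω → E} (hX : Measurable X) (hY : Measurable Y)
    {g : E → F} (hg : Measurable g) (l : Measure E) [SigmaFinite l] (τ : Measure F)
    [IsProbabilityMeasure τ]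
    (h : M.map (fun ω => (Y ω, X ω - g (Y ω))) = l.prod τ) :
    IsCondLaw M X Y (fun y => τ.map (fun x => g y + x)) := by
  have hr : Measurable fun ω => (Y ω, X ω - g (Y ω)) := hY.prodMk (hX.sub (hg.comp hY))
  -- As `τ` has mass one, the first marginal of the product is `l`; σ-finiteness of the law of `Y`
  -- is inherited from it.
  have hYl : M.map Y = l := by
    have := congrArg (fun m => m.map Prod.fst) h
    simpa [Measure.map_map measurable_fst hr, Function.comp_def] using this
  have hadd : Measurable fun p : E × F => (p.1, g p.1 + p.2) :=
    measurable_fst.prodMk ((hg.comp measurable_fst).add measurable_snd)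
  have := isMarkovKernel_translationKernel τ hg
  refine ⟨hYl ▸ inferInstance, translationKernel τ g, this, translationKernel_apply τ hg, ?_⟩
  have hXY : (fun ω => (Y ω, X ω))
      = (fun p : E × F => (p.1, g p.1 + p.2)) ∘ (fun ω => (Y ω, X ω - g (Y ω))) := by
    ext ω <;> simp
  rw [hYl, hXY, ← Measure.map_map hadd hr, h]
  refine Measure.ext_of_lintegral _ fun f hf => ?_
  have hfa : Measurable fun p : E × F => f (p.1, g p.1 + p.2) := hf.comp hadd
  rw [lintegral_map hf hadd, Measure.lintegral_compProd hf, lintegral_prod _ hfa.aemeasurable]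
  refine lintegral_congr fun y => ?_
  have hfy : Measurable fun x => f (y, x) := hf.comp measurable_prodMk_left
  rw [translationKernel_apply τ hg, lintegral_map hfy (measurable_const_add _)]

/-- Conditional law of `X` given `Y` when `X - g Y` and `Y` are independent. -/
theorem isCondLaw_of_indepFun_residual [AddCommGroup F] [MeasurableAdd₂ F] [MeasurableSub₂ F]
    {M : Measure Ω} [IsProbabilityMeasure M] {X : Ω → F} {Y : Ω → E} (hX : Measurable X)
    (hY : Measurable Y) {g : E → F} (hg : Measurable g)
    (h : IndepFun Y (fun ω => X ω - g (Y ω)) M) :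
    IsCondLaw M X Y (fun y => (M.map (fun ω => X ω - g (Y ω))).map (fun x => g y + x)) := by
  have hr : Measurable fun ω => X ω - g (Y ω) := hX.sub (hg.comp hY)
  have := Measure.isProbabilityMeasure_map (μ := M) hY.aemeasurable
  have := Measure.isProbabilityMeasure_map (μ := M) hr.aemeasurable
  exact isCondLaw_of_map_residual_eq_prod hX hY hg (M.map Y) _
    ((indepFun_iff_map_prod_eq_prod_map_map hY.aemeasurable hr.aemeasurable).1 h)

/-- Predictive laws: the conditional law of `X` given `Y` in the joint model is obtained by
integrating the conditional law given `Y` and the parameter over the posterior. -/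
theorem isCondLaw_predictive {π : Measure B} [SFinite π] {P : Kernel B Ω} [IsMarkovKernel P]
    {X : Ω → F} {Y : Ω → E} (hX : Measurable X) (hY : Measurable Y)
    {post : E → Measure B} {pred : E → Measure F} (K : Kernel (B × E) F) [IsMarkovKernel K]
    (Kp : Kernel E F) [IsMarkovKernel Kp] (hKp : ∀ z, Kp z = pred z)
    (hpost : IsCondLaw (π ⊗ₘ P) (fun q => q.1) (fun q => Y q.2) post)
    (hK : ∀ b, IsCondLaw (P b) X Y (fun z => K (b, z)))
    (hpred : ∀ z, (post z).bind (fun b => K (b, z)) = pred z) :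
    IsCondLaw (π ⊗ₘ P) (fun q => X q.2) (fun q => Y q.2) pred := by
  obtain ⟨hs, Q, hQ, hQp, hQeq⟩ := hpost
  refine ⟨hs, Kp, inferInstance, hKp, ?_⟩
  have hYX : Measurable fun ω => (Y ω, X ω) := hY.prodMk hX
  refine Measure.ext_of_lintegral _ fun f hf => ?_
  -- `φ (y, b)` is the conditional expectation of `f (Y, X)` given `Y = y` and the parameter `b`. It
  -- depends on the sample through `Y` only, so the posterior disintegration of the law of `(Y, b)`
  -- applies to it.
  let φ : E × B → ENNReal := fun p => ∫⁻ x, f (p.1, x) ∂K (p.2, p.1)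
  have hφ : Measurable φ := by
    have h0 : Measurable fun q : (B × E) × F => f (q.1.2, q.2) := by fun_prop
    have h1 := h0.lintegral_kernel_prod_right' (κ := K)
    exact h1.comp measurable_swap
  have h1 (b : B) : ∫⁻ ω, f (Y ω, X ω) ∂(P b) = ∫⁻ ω, φ (Y ω, b) ∂(P b) := by
    obtain ⟨_, κ, hκ, hκK, hκeq⟩ := hK b
    rw [← lintegral_map hf hYX, hκeq, Measure.lintegral_compProd hf,
      lintegral_map hf.lintegral_kernel_prod_right' hY]
    simp only [hκK, φ]
  have hYX2 : Measurable fun q : B × Ω => (Y q.2, X q.2) := hYX.comp measurable_snd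
  have hf2 : Measurable fun q : B × Ω => f (Y q.2, X q.2) := hf.comp hYX2
  rw [lintegral_map hf hYX2, Measure.lintegral_compProd hf2]
  simp only [h1]
  have hm : Measurable fun q : B × Ω => (Y q.2, q.1) := by fun_prop
  rw [← Measure.lintegral_compProd (f := fun q : B × Ω => φ (Y q.2, q.1)) (hφ.comp hm),
    ← lintegral_map hφ hm, hQeq, Measure.lintegral_compProd hφ, Measure.lintegral_compProd hf]
  refine lintegral_congr fun z => ?_
  rw [hKp, ← hpred, hQp, Measure.lintegral_bind]
  · exact (K.measurable.comp measurable_prodMk_right).aemeasurable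
  · exact (hf.comp measurable_prodMk_left).aemeasurable

/-- If under `P b` the observation `Y` is a `b`-dependent translate of a fixed noise, then functions
of the parameter and the observation can be computed with independent parameter and noise. -/
theorem map_compProd_eq_map_prod [Add E] [MeasurableAdd₂ E] {π : Measure B} [SFinite π]
    {P : Kernel B Ω} [IsSFiniteKernel P] {Y : Ω → E} (hY : Measurable Y) {a : B → E}
    (ha : Measurable a) {τ : Measure E} [SFinite τ]
    (h : ∀ b, (P b).map Y = τ.map (fun e => a b + e)) {Φ : B × E → F} (hΦ : Measurable Φ) :
    (π ⊗ₘ P).map (fun q => Φ (q.1, Y q.2)) = (π.prod τ).map (fun p => Φ (p.1, a p.1 + p.2)) := by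
  have h1 : Measurable fun q : B × Ω => Φ (q.1, Y q.2) := by fun_prop
  have h2 : Measurable fun p : B × E => Φ (p.1, a p.1 + p.2) := by fun_prop
  refine Measure.ext_of_lintegral _ fun f hf => ?_
  have hf1 : Measurable fun q : B × Ω => f (Φ (q.1, Y q.2)) := hf.comp h1
  have hf2 : Measurable fun p : B × E => f (Φ (p.1, a p.1 + p.2)) := hf.comp h2
  rw [lintegral_map hf h1, lintegral_map hf h2, Measure.lintegral_compProd hf1,
    lintegral_prod _ hf2.aemeasurable]
  refine lintegral_congr fun b => ?_
  have h3 : Measurable fun e => f (Φ (b, e)) := by fun_prop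
  have := congrArg (fun m => ∫⁻ e, f (Φ (b, e)) ∂m) (h b)
  simpa only [lintegral_map h3 hY, lintegral_map h3 (measurable_const_add (a b))] using this

end Disintegration

end CoKriging

namespace CoKriging

/-! ### Affine images of Gaussian vectors and Gaussian conditioning. -/

section GaussianVectors

variable {Ω ι κ l : Type*} [MeasurableSpace Ω]
  {P : Measure Ω} {X : Ω → ι → ℝ}

lemma hasGaussianLaw_add_const {E : Type*} [NormedAddCommGroup E] [NormedSpace ℝ E]
    [MeasurableSpace E] [BorelSpace E] [CompleteSpace E] [SecondCountableTopology E]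
    {X : Ω → E} (hX : HasGaussianLaw X P) (c : E) : HasGaussianLaw (fun ω => X ω + c) P where
  isGaussian_map := by
    have := hX.isGaussian_map
    have h : P.map (fun ω => X ω + c) = (P.map X).map (fun x => x + c) := by
      rw [AEMeasurable.map_map_of_aemeasurable (by fun_prop) hX.aemeasurable]; rfl
    rw [h]
    infer_instance

lemma hasGaussianLaw_linearMap {E F : Type*} [NormedAddCommGroup E] [NormedSpace ℝ E]
    [FiniteDimensional ℝ E] [MeasurableSpace E] [BorelSpace E] [NormedAddCommGroup F]
    [NormedSpace ℝ F] [MeasurableSpace F] [BorelSpace F] {X : Ω → E} (hX : HasGaussianLaw X P)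
    (L : E →ₗ[ℝ] F) : HasGaussianLaw (fun ω => L (X ω)) P :=
  hX.map_fun L.toContinuousLinearMap

lemma hasGaussianLaw_mulVec_add [Fintype ι] [Fintype κ] (hX : HasGaussianLaw X P) (M : Matrix κ ι ℝ) (c : κ → ℝ) :
    HasGaussianLaw (fun ω => M *ᵥ X ω + c) P :=
  hasGaussianLaw_add_const (hasGaussianLaw_linearMap hX M.mulVecLin) c

lemma memLp_two_coord [Finite ι] (hX : HasGaussianLaw X P) (i : ι) : MemLp (fun ω => X ω i) 2 P :=
  (hX.eval i).memLp_two

variable [Fintype ι]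

lemma covariance_dotProduct [IsProbabilityMeasure P] (hX : ∀ i, MemLp (fun ω => X ω i) 2 P)
    {C : Matrix ι ι ℝ} (hC : ∀ i j, cov[fun ω => X ω i, fun ω => X ω j; P] = C i j)
    (a b : ι → ℝ) (c c' : ℝ) :
    cov[fun ω => a ⬝ᵥ X ω + c, fun ω => b ⬝ᵥ X ω + c'; P] = a ⬝ᵥ C *ᵥ b := by
  have hint (a : ι → ℝ) : Integrable (fun ω => a ⬝ᵥ X ω) P :=
    integrable_finsetSum _ fun i _ => ((hX i).integrable (by norm_num)).const_mul (a i)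
  rw [covariance_add_const_left (hint a), covariance_add_const_right (hint b)]
  simp only [dotProduct]
  rw [covariance_fun_sum_fun_sum (fun i => (hX i).const_mul (a i))
    (fun i => (hX i).const_mul (b i))]
  simp only [covariance_const_mul_left, covariance_const_mul_right, hC, mulVec, dotProduct,
    Finset.mul_sum]
  exact Finset.sum_congr rfl fun i _ => Finset.sum_congr rfl fun j _ => by ring

lemma covariance_mulVec_add [IsProbabilityMeasure P] (hX : ∀ i, MemLp (fun ω => X ω i) 2 P)
    {C : Matrix ι ι ℝ} (hC : ∀ i j, cov[fun ω => X ω i, fun ω => X ω j; P] = C i j)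
    (M : Matrix κ ι ℝ) (N : Matrix l ι ℝ) (c : κ → ℝ) (c' : l → ℝ) (i : κ) (j : l) :
    cov[fun ω => (M *ᵥ X ω + c) i, fun ω => (N *ᵥ X ω + c') j; P] = (M * C * Nᵀ) i j := by
  refine (covariance_dotProduct hX hC (M i) (N j) (c i) (c' j)).trans ?_
  rw [Matrix.mul_assoc]
  simp only [mulVec, dotProduct, Matrix.mul_apply, Matrix.transpose_apply]

/-- The quadratic form at `a` is the variance of `a ⬝ᵥ X`. -/
lemma posSemidef_of_covariance [IsProbabilityMeasure P] (hX : ∀ i, MemLp (fun ω => X ω i) 2 P)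
    {C : Matrix ι ι ℝ} (hC : ∀ i j, cov[fun ω => X ω i, fun ω => X ω j; P] = C i j) :
    C.PosSemidef := by
  refine Matrix.PosSemidef.of_dotProduct_mulVec_nonneg ?_ fun a => ?_
  · ext i j
    simp [← hC, covariance_comm]
  · rw [star_trivial, ← covariance_dotProduct hX hC a a 0 0, covariance_self]
    · exact variance_nonneg _ _
    · simp only [dotProduct]
      have := fun i => (hX i).aestronglyMeasurable.aemeasurable
      fun_prop

/-- A Gaussian vector is determined by its mean and its covariance matrix. -/
theorem map_toLp_eq_multivariateGaussian [DecidableEq ι] (hX : HasGaussianLaw X P) {m : ι → ℝ}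
    {C : Matrix ι ι ℝ} (hm : ∀ i, ∫ ω, X ω i ∂P = m i)
    (hC : ∀ i j, cov[fun ω => X ω i, fun ω => X ω j; P] = C i j) :
    P.map (fun ω => WithLp.toLp 2 (X ω)) = multivariateGaussian (WithLp.toLp 2 m) C := by
  have := hX.isProbabilityMeasure
  have hX2 := memLp_two_coord hX
  have hPS := posSemidef_of_covariance hX2 hC
  have hXL : HasGaussianLaw (fun ω => WithLp.toLp 2 (X ω)) P := hX.toLp_pi 2
  have := hXL.isGaussian_map
  apply IsGaussian.ext
  · rw [integral_map hXL.aemeasurable (by fun_prop)]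
    simp only [id_eq, integral_id_multivariateGaussian]
    ext i
    have h := (EuclideanSpace.proj (𝕜 := ℝ) i : EuclideanSpace ℝ ι →L[ℝ] ℝ).integral_comp_comm
      hXL.integrable
    simp only [EuclideanSpace.coe_proj] at h
    exact h.symm.trans (hm i)
  · rw [← ContinuousLinearMap.toBilinForm_inj]
    refine LinearMap.BilinForm.ext_basis (EuclideanSpace.basisFun ι ℝ).toBasis fun i j => ?_
    rw [ContinuousLinearMap.toBilinForm_apply, ContinuousLinearMap.toBilinForm_apply,
      covarianceBilin_multivariateGaussian hPS, OrthonormalBasis.coe_toBasis,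
      covarianceBilin_apply_basisFun hX2, hC]
    simp

lemma multivariateGaussian_map_const_add [DecidableEq ι] (m : EuclideanSpace ℝ ι)
    (C : Matrix ι ι ℝ) :
    (multivariateGaussian 0 C).map (fun x => m + x) = multivariateGaussian m C := by
  simp only [multivariateGaussian]
  rw [Measure.map_map (by fun_prop) (by fun_prop)]
  simp [Function.comp_def]

/-- Affine images of a Gaussian vector with vanishing cross-covariance are independent. -/
theorem indepFun_mulVec_add [Fintype κ] [Fintype l] (hX : HasGaussianLaw X P) {C : Matrix ι ι ℝ}
    (hC : ∀ i j, cov[fun ω => X ω i, fun ω => X ω j; P] = C i j)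
    (M : Matrix κ ι ℝ) (N : Matrix l ι ℝ) (c : κ → ℝ) (c' : l → ℝ) (h : M * C * Nᵀ = 0) :
    IndepFun (fun ω => M *ᵥ X ω + c) (fun ω => N *ᵥ X ω + c') P := by
  have := hX.isProbabilityMeasure
  have hj : HasGaussianLaw (fun ω => (M *ᵥ X ω + c, N *ᵥ X ω + c')) P :=
    hasGaussianLaw_add_const (hasGaussianLaw_linearMap hX (M.mulVecLin.prod N.mulVecLin)) (c, c')
  refine HasGaussianLaw.indepFun_of_covariance_eval (X := fun i ω => (M *ᵥ X ω + c) i)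
    (Y := fun i ω => (N *ᵥ X ω + c') i) hj fun i j => ?_
  rw [covariance_mulVec_add (memLp_two_coord hX) hC, h, Matrix.zero_apply]

lemma integral_mulVec_add (hX : HasGaussianLaw X P) {m : ι → ℝ}
    (hm : ∀ i, ∫ ω, X ω i ∂P = m i) (M : Matrix κ ι ℝ) (c : κ → ℝ) (i : κ) :
    ∫ ω, (M *ᵥ X ω + c) i ∂P = (M *ᵥ m + c) i := by
  have := hX.isProbabilityMeasure
  have hi (j : ι) : Integrable (fun ω => M i j * X ω j) P :=
    ((memLp_two_coord hX j).integrable (by norm_num)).const_mul _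
  simp only [Pi.add_apply, mulVec, dotProduct]
  rw [integral_add (integrable_finsetSum _ fun j _ => hi j) (integrable_const _),
    integral_finsetSum _ fun j _ => hi j]
  simp [integral_const_mul, hm]

/-- The law of an affine image of a Gaussian vector. -/
theorem map_mulVec_add_eq_multivariateGaussian [Fintype κ] [DecidableEq κ] (hX : HasGaussianLaw X P) {m : ι → ℝ}
    {C : Matrix ι ι ℝ} (hm : ∀ i, ∫ ω, X ω i ∂P = m i)
    (hC : ∀ i j, cov[fun ω => X ω i, fun ω => X ω j; P] = C i j) (M : Matrix κ ι ℝ) (c : κ → ℝ) :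
    P.map (fun ω => WithLp.toLp 2 (M *ᵥ X ω + c))
      = multivariateGaussian (WithLp.toLp 2 (M *ᵥ m + c)) (M * C * Mᵀ) := by
  have := hX.isProbabilityMeasure
  exact map_toLp_eq_multivariateGaussian (hasGaussianLaw_mulVec_add hX M c)
    (integral_mulVec_add hX hm M c)
    (covariance_mulVec_add (memLp_two_coord hX) hC M M c c)

/-- The law of an affine functional of a Gaussian vector. -/
theorem map_dotProduct_add_eq_gaussianReal (hX : HasGaussianLaw X P) {m : ι → ℝ}
    {C : Matrix ι ι ℝ} (hm : ∀ i, ∫ ω, X ω i ∂P = m i)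
    (hC : ∀ i j, cov[fun ω => X ω i, fun ω => X ω j; P] = C i j) (a : ι → ℝ) (c : ℝ) :
    P.map (fun ω => a ⬝ᵥ X ω + c) = gaussianReal (a ⬝ᵥ m + c) (a ⬝ᵥ C *ᵥ a).toNNReal := by
  have := hX.isProbabilityMeasure
  have hg : HasGaussianLaw (fun ω => a ⬝ᵥ X ω + c) P :=
    (hasGaussianLaw_mulVec_add hX (Matrix.of fun _ : Unit => a) (fun _ => c)).eval ()
  rw [hg.map_eq_gaussianReal, ← covariance_self hg.aemeasurable,
    covariance_dotProduct (memLp_two_coord hX) hC]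
  congr 1
  exact integral_mulVec_add hX hm (Matrix.of fun _ : Unit => a) (fun _ => c) ()

/-- Gaussian conditioning (kriging): the conditional law of one coordinate functional given a
Gaussian vector with invertible covariance matrix. -/
theorem isCondLaw_kriging [DecidableEq ι] {W : Ω → ℝ} (hXm : Measurable X) (hWm : Measurable W)
    (hj : HasGaussianLaw (fun ω => Sum.elim (X ω) (fun _ : Unit => W ω)) P) {m : ι → ℝ} {w v : ℝ}
    {C : Matrix ι ι ℝ} {t : ι → ℝ} (hm : ∀ i, ∫ ω, X ω i ∂P = m i) (hw : ∫ ω, W ω ∂P = w)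
    (hC : ∀ i j, cov[fun ω => X ω i, fun ω => X ω j; P] = C i j)
    (ht : ∀ i, cov[W, fun ω => X ω i; P] = t i) (hv : Var[W; P] = v) (hdet : IsUnit C.det) :
    0 ≤ v - t ⬝ᵥ (C⁻¹ *ᵥ t) ∧
      IsCondLaw P W X (fun z => gaussianReal (w + t ⬝ᵥ (C⁻¹ *ᵥ (z - m)))
        (v - t ⬝ᵥ (C⁻¹ *ᵥ t)).toNNReal) := by
  have := hj.isProbabilityMeasure
  have hWg : HasGaussianLaw W P := hj.eval (Sum.inr ())
  have hXg : HasGaussianLaw X P := by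
    have := hasGaussianLaw_linearMap hj (LinearMap.funLeft ℝ ℝ (Sum.inl : ι → ι ⊕ Unit))
    exact this
  have hsym : Cᵀ = C := by
    have := (posSemidef_of_covariance (memLp_two_coord hXg) hC).isHermitian.eq
    simpa using this
  -- The kriging weights. The residual `W - k ⬝ᵥ X` has coefficient vector `(-k, 1)` on the joint
  -- vector `(X, W)`, whose covariance is `D` below.
  set k := C⁻¹ *ᵥ t with hk
  have hCk : C *ᵥ k = t := by simp [hk, Matrix.mulVec_mulVec, Matrix.mul_nonsing_inv _ hdet]
  have hkC (y : ι → ℝ) : t ⬝ᵥ (C⁻¹ *ᵥ y) = k ⬝ᵥ y := by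
    rw [Matrix.dotProduct_mulVec, ← Matrix.mulVec_transpose, Matrix.transpose_nonsing_inv, hsym]
  set D : Matrix (ι ⊕ Unit) (ι ⊕ Unit) ℝ := Matrix.fromBlocks C (Matrix.of fun i _ => t i)
    (Matrix.of fun _ i => t i) (Matrix.of fun _ _ => v) with hD
  have hDcov : ∀ i j, cov[fun ω => (Sum.elim (X ω) (fun _ : Unit => W ω)) i,
      fun ω => (Sum.elim (X ω) (fun _ : Unit => W ω)) j; P] = D i j := by
    rintro (i | i) (j | j)
    · simpa [hD] using hC i j
    · simpa [hD, covariance_comm] using ht i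
    · simpa [hD] using ht j
    · simpa [hD, covariance_self hWm.aemeasurable] using hv
  have hmean : ∀ i, ∫ ω, (Sum.elim (X ω) (fun _ : Unit => W ω)) i ∂P
      = (Sum.elim m (fun _ : Unit => w)) i := by
    rintro (i | i)
    · exact hm i
    · exact hw
  have hres (y : ι → ℝ) (s : ℝ) : Sum.elim (-k) (fun _ : Unit => (1 : ℝ)) ⬝ᵥ
      Sum.elim y (fun _ : Unit => s) = s - k ⬝ᵥ y := by
    simp [dotProduct]; ring
  -- Both facts needed are here: the zero block says that the residual is uncorrelated with `X`, the
  -- other entry is the residual variance.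
  have hDk : D *ᵥ Sum.elim (-k) (fun _ : Unit => (1 : ℝ))
      = Sum.elim (0 : ι → ℝ) (fun _ : Unit => v - t ⬝ᵥ k) := by
    rw [hD, Matrix.fromBlocks_mulVec]
    ext (i | i)
    · have := congrFun hCk i
      simp only [Sum.elim_comp_inl, Sum.elim_comp_inr, Sum.elim_inl, Pi.add_apply,
        Matrix.mulVec_neg, Pi.neg_apply, this]
      simp [mulVec, dotProduct]
    · simp [mulVec, dotProduct]; ring
  have hvar : Sum.elim (-k) (fun _ : Unit => (1 : ℝ)) ⬝ᵥ D *ᵥ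
      Sum.elim (-k) (fun _ : Unit => (1 : ℝ)) = v - t ⬝ᵥ k := by
    rw [hDk, hres]; simp
  have hlaw := map_dotProduct_add_eq_gaussianReal hj hmean hDcov
    (Sum.elim (-k) (fun _ : Unit => (1 : ℝ))) 0
  simp only [hres, hvar, add_zero] at hlaw
  have hindep : IndepFun X (fun ω => W ω - k ⬝ᵥ X ω) P := by
    have h0 := indepFun_mulVec_add hj hDcov
      (Matrix.fromCols (1 : Matrix ι ι ℝ) (0 : Matrix ι Unit ℝ))
      (Matrix.of fun _ : Unit => Sum.elim (-k) (fun _ : Unit => (1 : ℝ))) 0 0 (by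
        rw [Matrix.mul_assoc]
        have : D * (Matrix.of fun _ : Unit => Sum.elim (-k) (fun _ : Unit => (1 : ℝ)))ᵀ
            = Matrix.of fun i _ => Sum.elim (0 : ι → ℝ) (fun _ : Unit => v - t ⬝ᵥ k) i := by
          ext i j
          exact congrFun hDk i
        rw [this]
        ext i j
        simp [Matrix.mul_apply])
    have hev : Measurable fun f : Unit → ℝ => f () := measurable_pi_apply ()
    have h1 := h0.comp measurable_id hev
    convert h1 using 1
    · ext ω i
      simp [Matrix.mulVec, Matrix.fromCols, dotProduct, Matrix.one_apply]
    · ext ω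
      simpa [Matrix.mulVec] using (hres (X ω) (W ω)).symm
  constructor
  · rw [← hvar]
    simpa using (posSemidef_of_covariance (memLp_two_coord hj) hDcov).dotProduct_mulVec_nonneg
      (Sum.elim (-k) (fun _ : Unit => (1 : ℝ)))
  · have hg : Measurable fun y : ι → ℝ => k ⬝ᵥ y := by simp only [dotProduct]; fun_prop
    have := isCondLaw_of_indepFun_residual hWm hXm hg hindep
    simp only [hlaw, gaussianReal_map_const_add] at this
    convert this using 3 with z
    rw [hkC, dotProduct_sub]; ring

end GaussianVectors

end CoKriging

namespace CoKriging

/-! ### Linear Gaussian model with a Gaussian prior. -/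

section Bayes

variable {ι κ : Type*} [Fintype ι] [Fintype κ] [DecidableEq ι] [DecidableEq κ]

lemma hasGaussianLaw_ofLp (m : EuclideanSpace ℝ ι) (C : Matrix ι ι ℝ) :
    HasGaussianLaw (fun x : EuclideanSpace ℝ ι => x.ofLp) (multivariateGaussian m C) :=
  hasGaussianLaw_linearMap IsGaussian.hasGaussianLaw_id (WithLp.linearEquiv 2 ℝ (ι → ℝ)).toLinearMap

lemma integral_coord_multivariateGaussian (m : EuclideanSpace ℝ ι) (C : Matrix ι ι ℝ) (i : ι) :
    ∫ x, x i ∂(multivariateGaussian m C) = m i := by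
  have h := (EuclideanSpace.proj (𝕜 := ℝ) i : EuclideanSpace ℝ ι →L[ℝ] ℝ).integral_comp_comm
    (IsGaussian.integrable_fun_id (μ := multivariateGaussian m C))
  simpa using h

lemma measurable_ofLp_euclidean {ι : Type*} :
    Measurable (fun x : EuclideanSpace ℝ ι => x.ofLp) := by fun_prop

/-- The centred Gaussian law with covariance matrix `V` on `ι → ℝ`. -/
noncomputable def noiseLaw (V : Matrix ι ι ℝ) : Measure (ι → ℝ) :=
  (multivariateGaussian 0 V).map (fun x => x.ofLp)

instance isProbabilityMeasure_noiseLaw (V : Matrix ι ι ℝ) : IsProbabilityMeasure (noiseLaw V) :=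
  Measure.isProbabilityMeasure_map measurable_ofLp_euclidean.aemeasurable

lemma hasGaussianLaw_noiseLaw (V : Matrix ι ι ℝ) :
    HasGaussianLaw (fun x : ι → ℝ => x) (noiseLaw V) where
  isGaussian_map := by
    rw [show (fun x : ι → ℝ => x) = id from rfl, Measure.map_id]
    exact (hasGaussianLaw_ofLp 0 V).isGaussian_map

lemma integral_coord_noiseLaw (V : Matrix ι ι ℝ) (i : ι) : ∫ x, x i ∂(noiseLaw V) = 0 := by
  rw [noiseLaw, integral_map measurable_ofLp_euclidean.aemeasurable
    (measurable_pi_apply i).aestronglyMeasurable]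
  simpa using integral_coord_multivariateGaussian 0 V i

lemma covariance_coord_noiseLaw {V : Matrix ι ι ℝ} (hV : V.PosSemidef) (i j : ι) :
    cov[fun x => x i, fun x => x j; noiseLaw V] = V i j := by
  rw [noiseLaw, covariance_map_fun (measurable_pi_apply i).aestronglyMeasurable
    (measurable_pi_apply j).aestronglyMeasurable measurable_ofLp_euclidean.aemeasurable]
  exact covariance_eval_multivariateGaussian hV i j

/-- A Gaussian vector with covariance `V` is a translate of the noise law. -/
lemma map_eq_map_noiseLaw {Ω : Type*} [MeasurableSpace Ω] {P : Measure Ω} {X : Ω → ι → ℝ}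
    (hXm : Measurable X) (hX : HasGaussianLaw X P) {m : ι → ℝ} {V : Matrix ι ι ℝ}
    (hm : ∀ i, ∫ ω, X ω i ∂P = m i)
    (hV : ∀ i j, cov[fun ω => X ω i, fun ω => X ω j; P] = V i j) :
    P.map X = (noiseLaw V).map (fun e => m + e) := by
  have h := map_toLp_eq_multivariateGaussian hX hm hV
  rw [← multivariateGaussian_map_const_add] at h
  have h2 := congrArg (fun M => M.map (fun x : EuclideanSpace ℝ ι => x.ofLp)) h
  simp only at h2
  rw [Measure.map_map measurable_ofLp_euclidean (by fun_prop),
    Measure.map_map measurable_ofLp_euclidean (by fun_prop)] at h2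
  rw [noiseLaw, Measure.map_map (by fun_prop) measurable_ofLp_euclidean]
  exact h2

/-- Linear Gaussian model with Gaussian prior: residual of the posterior mean. -/
theorem map_residual_gaussian_prior {V : Matrix ι ι ℝ} (hV : V.PosSemidef) {S : Matrix κ κ ℝ}
    (hS : S.PosSemidef) {H : Matrix ι κ ℝ} {G : Matrix κ ι ℝ} (hG : G * V = Hᵀ)
    {A T : Matrix κ κ ℝ} (hT : T * S = 1) (hA : A * (G * H + T) = 1) (b : κ → ℝ) (c : ι → ℝ) :
    ((multivariateGaussian (WithLp.toLp 2 b) S).prod (noiseLaw V)).map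
        (fun p => (H *ᵥ p.1.ofLp + c + p.2,
          p.1 - WithLp.toLp 2 (A *ᵥ (G *ᵥ (H *ᵥ p.1.ofLp + c + p.2 - c) + T *ᵥ b)))) =
      (((multivariateGaussian (WithLp.toLp 2 b) S).prod (noiseLaw V)).map
        (fun p => H *ᵥ p.1.ofLp + c + p.2)).prod (multivariateGaussian 0 A) := by
  -- Here `G` plays the role of `Hᵀ V⁻¹` and `T` that of the prior precision `S⁻¹`. Only the
  -- relation `G * V = Hᵀ` is used, so `V` may be singular.
  set Q := (multivariateGaussian (WithLp.toLp 2 b) S).prod (noiseLaw V) with hQ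
  have : IsGaussian (noiseLaw V) := (hasGaussianLaw_ofLp 0 V).isGaussian_map
  let X : EuclideanSpace ℝ κ × (ι → ℝ) → κ ⊕ ι → ℝ := fun p => Sum.elim p.1.ofLp p.2
  have hX : HasGaussianLaw X Q := by
    have hid : HasGaussianLaw (id : EuclideanSpace ℝ κ × (ι → ℝ) → _) Q :=
      IsGaussian.hasGaussianLaw_id
    let L : (EuclideanSpace ℝ κ × (ι → ℝ)) →ₗ[ℝ] (κ ⊕ ι → ℝ) :=
      { toFun := X
        map_add' := by intro x y; ext (i | i) <;> simp [X]
        map_smul' := by intro r y; ext (i | i) <;> simp [X] }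
    exact hasGaussianLaw_linearMap hid L
  have h1 (i : κ) : MemLp (fun x : EuclideanSpace ℝ κ => x i) 2
      (multivariateGaussian (WithLp.toLp 2 b) S) := memLp_two_coord (hasGaussianLaw_ofLp _ S) i
  have h2 (i : ι) : MemLp (fun x : ι → ℝ => x i) 2 (noiseLaw V) :=
    memLp_two_coord (hasGaussianLaw_noiseLaw V) i
  have hfst : Q.map Prod.fst = multivariateGaussian (WithLp.toLp 2 b) S := by
    simp [hQ]
  have hsnd : Q.map Prod.snd = noiseLaw V := by
    simp [hQ]
  have hcov : ∀ i j, cov[fun ω => X ω i, fun ω => X ω j; Q] = fromBlocks S 0 0 V i j := by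
    rintro (i | i) (j | j)
    · have h := covariance_map_fun (μ := Q) (Z := Prod.fst) (X := fun x => x i) (Y := fun x => x j)
        (by fun_prop) (by fun_prop) measurable_fst.aemeasurable
      rw [hfst, covariance_eval_multivariateGaussian hS] at h
      exact h.symm
    · exact covariance_fst_snd_prod (h1 i) (h2 j)
    · rw [covariance_comm]
      exact covariance_fst_snd_prod (h1 j) (h2 i)
    · have h := covariance_map_fun (μ := Q) (Z := Prod.snd) (X := fun x => x i) (Y := fun x => x j)
        (measurable_pi_apply i).aestronglyMeasurable (measurable_pi_apply j).aestronglyMeasurable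
        measurable_snd.aemeasurable
      rw [hsnd, covariance_coord_noiseLaw hV] at h
      exact h.symm
  have hmean : ∀ i, ∫ ω, X ω i ∂Q = (Sum.elim b 0 : κ ⊕ ι → ℝ) i := by
    rintro (i | i)
    · have h := integral_map (μ := Q) (φ := Prod.fst) measurable_fst.aemeasurable
        (f := fun x : EuclideanSpace ℝ κ => x i) (by fun_prop)
      rw [hfst, integral_coord_multivariateGaussian] at h
      exact h.symm
    · have h := integral_map (μ := Q) (φ := Prod.snd) measurable_snd.aemeasurable
        (f := fun x : ι → ℝ => x i) (measurable_pi_apply i).aestronglyMeasurable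
      rw [hsnd, integral_coord_noiseLaw] at h
      exact h.symm
  have hY : (fun p : EuclideanSpace ℝ κ × (ι → ℝ) => H *ᵥ p.1.ofLp + c + p.2)
      = fun p => fromCols H (1 : Matrix ι ι ℝ) *ᵥ X p + c := by
    ext p i
    simp [X, fromCols_mulVec]
    ring
  -- Writing `β = A (G H + T) β` cancels the `G H β` terms and leaves `A T (β - b) - A G e`, affine
  -- in the independent pair `(β, e)`.
  have hres : (fun p : EuclideanSpace ℝ κ × (ι → ℝ) =>
        p.1 - WithLp.toLp 2 (A *ᵥ (G *ᵥ (H *ᵥ p.1.ofLp + c + p.2 - c) + T *ᵥ b)))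
      = fun p => WithLp.toLp 2 (fromCols (A * T) (-(A * G)) *ᵥ X p + (-((A * T) *ᵥ b))) := by
    funext p
    apply (WithLp.linearEquiv 2 ℝ (κ → ℝ)).injective
    have hβ : p.1.ofLp = A *ᵥ (G *ᵥ (H *ᵥ p.1.ofLp)) + A *ᵥ (T *ᵥ p.1.ofLp) := by
      rw [← Matrix.mulVec_add, Matrix.mulVec_mulVec, ← Matrix.add_mulVec, Matrix.mulVec_mulVec, hA,
        Matrix.one_mulVec]
    ext i
    have hβi := congrFun hβ i
    have hc : H *ᵥ p.1.ofLp + c + p.2 - c = H *ᵥ p.1.ofLp + p.2 := by abel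
    rw [hc]
    simp only [WithLp.linearEquiv_apply, AddEquiv.toEquiv_eq_coe,
      Matrix.mulVec_add, Pi.add_apply, X, fromCols_mulVec, Sum.elim_comp_inl,
      Sum.elim_comp_inr, Matrix.neg_mulVec, ← Matrix.mulVec_mulVec] at hβi ⊢
    simp only [Matrix.mulVec_mulVec] at hβi
    simp
    linarith
  have hlaw := map_mulVec_add_eq_multivariateGaussian hX hmean hcov
    (fromCols (A * T) (-(A * G))) (-((A * T) *ᵥ b))
  -- The sum collapses to `A * (A * (G * H + T))ᵀ = A`.
  have hvar : fromCols (A * T) (-(A * G)) * fromBlocks S 0 0 V * (fromCols (A * T) (-(A * G)))ᵀ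
      = A := by
    rw [fromCols_mul_fromBlocks, transpose_fromCols, fromCols_mul_fromRows]
    simp only [Matrix.mul_zero, add_zero, zero_add, Matrix.transpose_neg, Matrix.neg_mul,
      Matrix.mul_neg, neg_neg]
    have h : A * (A * T)ᵀ + A * Hᵀ * (A * G)ᵀ = A * (A * (G * H + T))ᵀ := by
      simp only [Matrix.mul_add, Matrix.transpose_add, Matrix.transpose_mul, Matrix.mul_assoc,
        add_comm]
    rw [Matrix.mul_assoc A T S, hT, Matrix.mul_assoc A G V, hG, Matrix.mul_one, h, hA,
      Matrix.transpose_one, Matrix.mul_one]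
  have hm0 : fromCols (A * T) (-(A * G)) *ᵥ Sum.elim b 0 + (-((A * T) *ᵥ b)) = 0 := by
    simp [fromCols_mulVec]
  rw [hvar, hm0, ← hres] at hlaw
  -- The prior contributes `A T S Hᵀ = A Hᵀ` and the noise `-A G V = -A Hᵀ`.
  have hcross : fromCols (A * T) (-(A * G)) * fromBlocks S 0 0 V *
      (fromCols H (1 : Matrix ι ι ℝ))ᵀ = 0 := by
    rw [fromCols_mul_fromBlocks, transpose_fromCols, fromCols_mul_fromRows]
    simp only [Matrix.mul_zero, add_zero, zero_add, Matrix.transpose_one, Matrix.mul_one,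
      Matrix.neg_mul]
    rw [Matrix.mul_assoc A T S, hT, Matrix.mul_assoc A G V, hG, Matrix.mul_one, add_neg_cancel]
  have hind := (indepFun_mulVec_add hX hcov (fromCols (A * T) (-(A * G)))
    (fromCols H (1 : Matrix ι ι ℝ)) (-((A * T) *ᵥ b)) c hcross).symm
  have hind' := hind.comp (φ := id) (ψ := fun x : κ → ℝ => (WithLp.toLp 2 x : EuclideanSpace ℝ κ))
    measurable_id (by fun_prop)
  have hYm : Measurable fun p : EuclideanSpace ℝ κ × (ι → ℝ) => H *ᵥ p.1.ofLp + c + p.2 := by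
    fun_prop
  have hrm : Measurable fun p : EuclideanSpace ℝ κ × (ι → ℝ) =>
      p.1 - WithLp.toLp 2 (A *ᵥ (G *ᵥ (H *ᵥ p.1.ofLp + c + p.2 - c) + T *ᵥ b)) := by
    fun_prop
  have hfin := (indepFun_iff_map_prod_eq_prod_map_map hYm.aemeasurable hrm.aemeasurable).1
    (by rw [hY, hres]; exact hind')
  rw [hfin, hlaw]
  rfl

end Bayes

end CoKriging

namespace CoKriging

/-! ### Linear Gaussian model with a flat prior, and Gaussian mixtures of Gaussians. -/

section FlatPrior

variable {ι κ : Type*} [Fintype ι] [Fintype κ] [DecidableEq ι] [DecidableEq κ]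

/-- Linear Gaussian model with flat prior: residual of the generalized least squares estimator. -/
theorem map_residual_flat_prior {V : Matrix ι ι ℝ} (hV : V.PosSemidef) {H : Matrix ι κ ℝ}
    {G : Matrix κ ι ℝ} (hG : G * V = Hᵀ) {A : Matrix κ κ ℝ} (hA : A * (G * H) = 1) (c : ι → ℝ) :
    ∃ l : Measure (ι → ℝ), SigmaFinite l ∧
      ((volume : Measure (EuclideanSpace ℝ κ)).prod (noiseLaw V)).map
        (fun p => (H *ᵥ p.1.ofLp + c + p.2,
          p.1 - WithLp.toLp 2 (A *ᵥ (G *ᵥ (H *ᵥ p.1.ofLp + c + p.2 - c))))) =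
      l.prod (multivariateGaussian 0 A) := by
  -- Since `A G H = 1`, the estimation residual is `u e = -A G e`, free of `β`. The noise splits as
  -- `e = w e - H (u e)`, where `w e` is the part killed by `A G`; `w` and `u` are independent under
  -- the noise law.
  set w : (ι → ℝ) → ι → ℝ := fun e => (1 - H * (A * G)) *ᵥ e + 0 with hw
  set u : (ι → ℝ) → EuclideanSpace ℝ κ := fun e => WithLp.toLp 2 ((-(A * G)) *ᵥ e + 0) with hu
  have hwm : Measurable w := by fun_prop
  have hum : Measurable u := by fun_prop
  have hβ (β : κ → ℝ) : A *ᵥ (G *ᵥ (H *ᵥ β)) = β := by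
    rw [Matrix.mulVec_mulVec, Matrix.mulVec_mulVec, Matrix.mul_assoc, hA, Matrix.one_mulVec]
  have hAt : Hᵀ * Gᵀ * Aᵀ = 1 := by
    rw [← Matrix.transpose_mul, ← Matrix.transpose_mul, hA, Matrix.transpose_one]
  have hvar : (-(A * G)) * V * (-(A * G))ᵀ = A := by
    rw [Matrix.transpose_neg, Matrix.mul_neg, Matrix.neg_mul, Matrix.neg_mul, neg_neg,
      Matrix.mul_assoc A, hG, Matrix.transpose_mul, Matrix.mul_assoc, ← Matrix.mul_assoc Hᵀ, hAt,
      Matrix.mul_one]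
  have hVt : Vᵀ = V := by simpa using hV.isHermitian.eq
  have hAs : Aᵀ = A := by
    have h := congrArg Matrix.transpose hvar
    rwa [Matrix.transpose_mul, Matrix.transpose_mul, hVt, Matrix.transpose_transpose,
      ← Matrix.mul_assoc, hvar, eq_comm] at h
  have hcross : (1 - H * (A * G)) * V * (-(A * G))ᵀ = 0 := by
    rw [Matrix.sub_mul, Matrix.one_mul, Matrix.mul_assoc H, Matrix.mul_assoc A, hG,
      Matrix.transpose_neg, Matrix.mul_neg, Matrix.sub_mul, Matrix.transpose_mul]
    have hVG : V * Gᵀ = H := by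
      have h := congrArg Matrix.transpose hG
      rwa [Matrix.transpose_mul, hVt, Matrix.transpose_transpose] at h
    rw [← Matrix.mul_assoc V, hVG, Matrix.mul_assoc H, Matrix.mul_assoc A,
      ← Matrix.mul_assoc Hᵀ, hAt, Matrix.mul_one, hAs, sub_self, neg_zero]
  have hulaw : (noiseLaw V).map u = multivariateGaussian 0 A := by
    have h := map_mulVec_add_eq_multivariateGaussian (hasGaussianLaw_noiseLaw V) (m := 0)
      (integral_coord_noiseLaw V) (covariance_coord_noiseLaw hV) (-(A * G)) 0
    rw [hvar] at h
    rw [Matrix.mulVec_zero, add_zero] at h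
    exact h
  have hind : IndepFun w u (noiseLaw V) :=
    (indepFun_mulVec_add (hasGaussianLaw_noiseLaw V) (covariance_coord_noiseLaw hV) _ _ 0 0
      hcross).comp (φ := id) (ψ := fun x : κ → ℝ => (WithLp.toLp 2 x : EuclideanSpace ℝ κ))
      measurable_id (by fun_prop)
  have hwu := (indepFun_iff_map_prod_eq_prod_map_map hwm.aemeasurable hum.aemeasurable).1 hind
  rw [hulaw] at hwu
  have hsm : Measurable fun p : EuclideanSpace ℝ κ × (ι → ℝ) => H *ᵥ p.1.ofLp + c + w p.2 := by
    fun_prop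
  refine ⟨((volume : Measure (EuclideanSpace ℝ κ)).prod (noiseLaw V)).map
    (fun p => H *ᵥ p.1.ofLp + c + w p.2), ?_, ?_⟩
  · have hg : Measurable fun z : ι → ℝ =>
        (WithLp.toLp 2 (A *ᵥ (G *ᵥ (z - c))) : EuclideanSpace ℝ κ) := by fun_prop
    -- The estimator `z ↦ A G (z - c)` recovers `β` from `H β + c + w e`, so it pushes this measure
    -- to Lebesgue measure, and σ-finiteness passes back to the source.
    refine SigmaFinite.of_map _ hg.aemeasurable ?_
    rw [Measure.map_map hg hsm]
    have : ((fun z : ι → ℝ => (WithLp.toLp 2 (A *ᵥ (G *ᵥ (z - c))) : EuclideanSpace ℝ κ)) ∘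
        fun p : EuclideanSpace ℝ κ × (ι → ℝ) => H *ᵥ p.1.ofLp + c + w p.2) = Prod.fst := by
      funext p
      have hwz : A *ᵥ (G *ᵥ (w p.2)) = 0 := by
        simp only [hw, add_zero, Matrix.sub_mulVec, Matrix.one_mulVec, ← Matrix.mulVec_mulVec,
          Matrix.mulVec_sub, hβ, sub_self]
      have : H *ᵥ p.1.ofLp + c + w p.2 - c = H *ᵥ p.1.ofLp + w p.2 := by abel
      simp only [Function.comp_apply, this, Matrix.mulVec_add, hwz, hβ, add_zero]
    rw [this]
    simp only [Measure.map_fst_prod, measure_univ, one_smul]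
    infer_instance
  · have hm1 : Measurable fun p : EuclideanSpace ℝ κ × (ι → ℝ) => (H *ᵥ p.1.ofLp + c + p.2,
        p.1 - WithLp.toLp 2 (A *ᵥ (G *ᵥ (H *ᵥ p.1.ofLp + c + p.2 - c)))) := by fun_prop
    have hres (p : EuclideanSpace ℝ κ × (ι → ℝ)) :
        (H *ᵥ p.1.ofLp + c + p.2,
          p.1 - WithLp.toLp 2 (A *ᵥ (G *ᵥ (H *ᵥ p.1.ofLp + c + p.2 - c)))) =
        (H *ᵥ (p.1 - u p.2).ofLp + c + w p.2, u p.2) := by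
      have h0 : H *ᵥ p.1.ofLp + c + p.2 - c = H *ᵥ p.1.ofLp + p.2 := by abel
      rw [h0, Matrix.mulVec_add, Matrix.mulVec_add, hβ]
      ext i
      · simp [hu, hw, Matrix.neg_mulVec, Matrix.mulVec_add, Matrix.sub_mulVec,
          Matrix.mulVec_mulVec]
        ring
      · simp [hu, Matrix.neg_mulVec, Matrix.mulVec_mulVec]
    refine Measure.ext_of_lintegral _ fun f hf => ?_
    rw [lintegral_map hf hm1]
    simp only [hres]
    have hf1 : Measurable fun p : EuclideanSpace ℝ κ × (ι → ℝ) =>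
        f (H *ᵥ (p.1 - u p.2).ofLp + c + w p.2, u p.2) := by fun_prop
    have hf2 : Measurable fun p : EuclideanSpace ℝ κ × (ι → ℝ) =>
        f (H *ᵥ p.1.ofLp + c + w p.2, u p.2) := by fun_prop
    have hf3 : Measurable fun p : EuclideanSpace ℝ κ × (ι → ℝ) =>
        ∫⁻ y, f (H *ᵥ p.1.ofLp + c + w p.2, y) ∂(multivariateGaussian 0 A) :=
      hf.lintegral_prod_right'.comp hsm
    rw [lintegral_prod_symm _ hf1.aemeasurable]
    -- The observation is `H (β - u e) + c + w e`. For each fixed noise, translating `β` by `u e`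
    -- removes `u e` from it, after which independence of `w` and `u` yields the product.
    have hshift (e : ι → ℝ) :
        ∫⁻ β : EuclideanSpace ℝ κ, f (H *ᵥ (β - u e).ofLp + c + w e, u e) =
          ∫⁻ β : EuclideanSpace ℝ κ, f (H *ᵥ β.ofLp + c + w e, u e) :=
      lintegral_sub_right_eq_self
        (fun β : EuclideanSpace ℝ κ => f (H *ᵥ β.ofLp + c + w e, u e)) (u e)
    simp only [hshift]
    rw [← lintegral_prod_symm (fun p : EuclideanSpace ℝ κ × (ι → ℝ) =>
      f (H *ᵥ p.1.ofLp + c + w p.2, u p.2)) hf2.aemeasurable, lintegral_prod _ hf2.aemeasurable,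
      lintegral_prod _ hf.aemeasurable, lintegral_map hf.lintegral_prod_right' hsm,
      lintegral_prod _ hf3.aemeasurable]
    refine lintegral_congr fun β => ?_
    have hfβ : Measurable fun q : (ι → ℝ) × EuclideanSpace ℝ κ =>
        f (H *ᵥ β.ofLp + c + q.1, q.2) := by fun_prop
    have h := congrArg (fun m => ∫⁻ q, f (H *ᵥ β.ofLp + c + q.1, q.2) ∂m) hwu
    simp only at h
    rw [lintegral_map hfβ (hwm.prodMk hum), lintegral_prod _ hfβ.aemeasurable,
      lintegral_map hfβ.lintegral_prod_right' hwm] at h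
    exact h

/-- Integrating a Gaussian law whose mean is an affine functional of a Gaussian vector. -/
theorem multivariateGaussian_bind_gaussianReal (m : κ → ℝ) {A : Matrix κ κ ℝ} (hA : A.PosSemidef)
    (a : κ → ℝ) (c : ℝ) (v : NNReal) :
    (multivariateGaussian (WithLp.toLp 2 m) A).bind
        (fun β => gaussianReal (a ⬝ᵥ β.ofLp + c) v) =
      gaussianReal (a ⬝ᵥ m + c) ((a ⬝ᵥ A *ᵥ a).toNNReal + v) := by
  have hg : Measurable fun β : EuclideanSpace ℝ κ => a ⬝ᵥ β.ofLp + c := by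
    simp only [dotProduct]; fun_prop
  have hker (β : EuclideanSpace ℝ κ) : gaussianReal (a ⬝ᵥ β.ofLp + c) v =
      translationKernel (gaussianReal 0 v) (fun β : EuclideanSpace ℝ κ => a ⬝ᵥ β.ofLp + c) β := by
    rw [translationKernel_apply _ hg, gaussianReal_map_const_add, zero_add]
  have hlaw := map_dotProduct_add_eq_gaussianReal (hasGaussianLaw_ofLp (WithLp.toLp 2 m) A)
    (integral_coord_multivariateGaussian _ A)
    (covariance_eval_multivariateGaussian hA) a c
  -- The mixture is the law of a sum: the random mean plus an independent centred Gaussian of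
  -- variance `v`.
  have hconv : gaussianReal (a ⬝ᵥ m + c) ((a ⬝ᵥ A *ᵥ a).toNNReal + v) =
      gaussianReal (a ⬝ᵥ m + c) (a ⬝ᵥ A *ᵥ a).toNNReal ∗ gaussianReal 0 v := by
    rw [gaussianReal_conv_gaussianReal, add_zero]
  have hlaw' : (multivariateGaussian (WithLp.toLp 2 m) A).map
      (fun β : EuclideanSpace ℝ κ => a ⬝ᵥ β.ofLp + c) =
      gaussianReal (a ⬝ᵥ m + c) (a ⬝ᵥ A *ᵥ a).toNNReal := hlaw
  rw [hconv, ← hlaw']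
  simp only [hker]
  refine Measure.ext_of_lintegral _ fun f hf => ?_
  have hfm : Measurable fun p : ℝ × ℝ => f (p.1 + p.2) := by fun_prop
  rw [Measure.lintegral_bind (Kernel.measurable _).aemeasurable hf.aemeasurable,
    Measure.lintegral_conv hf, lintegral_map hfm.lintegral_prod_right' hg]
  refine lintegral_congr fun β => ?_
  rw [translationKernel_apply _ hg, lintegral_map hf (measurable_const_add _)]

end FlatPrior

end CoKriging

namespace CoKriging

/-! ### Algebra of the co-kriging matrices. -/

namespace Setup

variable {d n₁ n₂ p₁ p₂ : ℕ} (S : Setup d n₁ n₂ p₁ p₂)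

/-- The columns of `H` that multiply `β₁`. -/
def H₁ : Matrix (Fin n₁ ⊕ Fin n₂) (Fin p₁) ℝ :=
  fromRows S.F₁ (S.ρ • designMatrix S.f₁ S.D₂)

/-- The part of the mean of the observations that does not depend on `β₁`. -/
def offset : Fin n₁ ⊕ Fin n₂ → ℝ := Sum.elim 0 (designMatrix S.f₂ S.D₂ *ᵥ S.β₂)

/-- The weights `(F₁ᵀ R₁⁻¹ / σ₁², 0)` of the observations in the score. -/
noncomputable def scoreMatrix : Matrix (Fin p₁) (Fin n₁ ⊕ Fin n₂) ℝ :=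
  fromCols (S.F₁ᵀ * ((S.σ₁ ^ 2)⁻¹ • S.R₁⁻¹)) 0

lemma H_mulVec (β : Fin p₁ → ℝ) : S.H *ᵥ Sum.elim β S.β₂ = S.H₁ *ᵥ β + S.offset := by
  ext (i | i) <;> simp [H, H₁, offset, fromBlocks_mulVec]

lemma scoreMatrix_mulVec (z : Fin n₁ ⊕ Fin n₂ → ℝ) :
    S.scoreMatrix *ᵥ z = (S.F₁ᵀ * ((S.σ₁ ^ 2)⁻¹ • S.R₁⁻¹)) *ᵥ (fun i => z (Sum.inl i)) := by
  rw [scoreMatrix, fromCols_mulVec, Matrix.zero_mulVec, add_zero]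
  rfl

/-- The offset lives on the expensive block, where the score weights vanish; hence `β₂` does not
enter the posterior of `β₁`. -/
lemma scoreMatrix_mulVec_sub_offset (z : Fin n₁ ⊕ Fin n₂ → ℝ) :
    S.scoreMatrix *ᵥ (z - S.offset) = S.scoreMatrix *ᵥ z := by
  rw [scoreMatrix_mulVec, scoreMatrix_mulVec]
  congr 1
  ext i
  simp [offset]

lemma scoreMatrix_mul_H₁ :
    S.scoreMatrix * S.H₁ = S.F₁ᵀ * ((S.σ₁ ^ 2)⁻¹ • S.R₁⁻¹) * S.F₁ := by
  simp [scoreMatrix, H₁, fromCols_mul_fromRows]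

lemma exists_nesting : ∃ e : Fin n₂ → Fin n₁, ∀ j, S.D₁ (e j) = S.D₂ j := by
  choose e he using fun j => S.nested (Set.mem_range_self j)
  exact ⟨e, he⟩

lemma sigma₁_sq_ne_zero : S.σ₁ ^ 2 ≠ 0 := pow_ne_zero _ S.σ₁_pos.ne'

/-- This is where nesting decides the form of the posterior. The columns of `R₁(D₁, D₂)` are columns
of `R₁`, so `R₁⁻¹ R₁(D₁, D₂)` merely selects columns and turns `F₁ᵀ` into `F₁(D₂)ᵀ`. The relation
avoids writing out `V⁻¹`. -/
lemma scoreMatrix_mul_V (hR₁ : IsUnit S.R₁.det) : S.scoreMatrix * S.V = S.H₁ᵀ := by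
  obtain ⟨e, he⟩ := S.exists_nesting
  have hR : corrMatrix S.r₁ S.D₁ S.D₂ = S.R₁.submatrix id e := by
    ext i j; simp [corrMatrix, R₁, he]
  have hF : designMatrix S.f₁ S.D₂ = S.F₁.submatrix e id := by
    ext i j; simp [designMatrix, F₁, he]
  have hs := S.sigma₁_sq_ne_zero
  rw [scoreMatrix, V, fromCols_mul_fromBlocks, H₁, transpose_fromRows]
  simp only [Matrix.zero_mul, add_zero, hR, hF]
  congr 1
  · rw [Matrix.mul_assoc, Matrix.smul_mul, Matrix.mul_smul, Matrix.mul_smul, Matrix.mul_smul, smul_smul,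
      inv_mul_cancel₀ hs, one_smul, Matrix.nonsing_inv_mul _ hR₁, Matrix.mul_one]
  · have h1 : S.R₁⁻¹ * S.R₁.submatrix id e = (1 : Matrix _ _ ℝ).submatrix id e := by
      rw [← Matrix.nonsing_inv_mul _ hR₁]; rfl
    rw [Matrix.mul_assoc, Matrix.smul_mul, Matrix.mul_smul, Matrix.mul_smul, Matrix.mul_smul, smul_smul,
      h1, mul_comm S.ρ, inv_mul_cancel_left₀ hs]
    ext i j
    simp [Matrix.mul_apply, Matrix.one_apply]

/-- Once `Z₁` is known on `D₁ ⊇ D₂`, only `δ` remains random in `Z₂` on `D₂`; accordingly the Schur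
complement of the cheap block is `σ₂² R₂`. -/
lemma isUnit_det_V (hR₁ : IsUnit S.R₁.det) (hR₂ : IsUnit S.R₂.det) : IsUnit S.V.det := by
  obtain ⟨e, he⟩ := S.exists_nesting
  have hR12 : corrMatrix S.r₁ S.D₁ S.D₂ = S.R₁.submatrix id e := by
    ext i j; simp [corrMatrix, R₁, he]
  have hR21 : corrMatrix S.r₁ S.D₂ S.D₁ = S.R₁.submatrix e id := by
    ext i j; simp [corrMatrix, R₁, he]
  have hR22 : corrMatrix S.r₁ S.D₂ S.D₂ = S.R₁.submatrix e e := by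
    ext i j; simp [corrMatrix, R₁, he]
  have hs := S.sigma₁_sq_ne_zero
  have hA : IsUnit (S.σ₁ ^ 2 • S.R₁).det := by
    rw [Matrix.det_smul]
    exact (IsUnit.mk0 _ (pow_ne_zero _ hs)).mul hR₁
  have hB : IsUnit (S.σ₂ ^ 2 • S.R₂).det := by
    rw [Matrix.det_smul]
    exact (IsUnit.mk0 _ (pow_ne_zero _ (pow_ne_zero _ S.σ₂_pos.ne'))).mul hR₂
  let _ := Matrix.invertibleOfIsUnitDet _ hA
  have hinv : ⅟(S.σ₁ ^ 2 • S.R₁) = (S.σ₁ ^ 2)⁻¹ • S.R₁⁻¹ := by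
    refine invOf_eq_right_inv ?_
    rw [Matrix.smul_mul, Matrix.mul_smul, smul_smul, mul_inv_cancel₀ hs, one_smul,
      Matrix.mul_nonsing_inv _ hR₁]
  have h1 : S.R₁⁻¹ * S.R₁.submatrix id e = (1 : Matrix _ _ ℝ).submatrix id e := by
    rw [← Matrix.nonsing_inv_mul _ hR₁]; rfl
  have h2 : S.R₁.submatrix e id * (1 : Matrix (Fin n₁) (Fin n₁) ℝ).submatrix id e
      = S.R₁.submatrix e e := by
    ext i j; simp [Matrix.mul_apply, Matrix.one_apply]
  have hschur : (S.ρ ^ 2 * S.σ₁ ^ 2) • S.R₁.submatrix e e + S.σ₂ ^ 2 • S.R₂ -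
      (S.ρ * S.σ₁ ^ 2) • S.R₁.submatrix e id * ⅟(S.σ₁ ^ 2 • S.R₁) *
        ((S.ρ * S.σ₁ ^ 2) • S.R₁.submatrix id e) = S.σ₂ ^ 2 • S.R₂ := by
    rw [hinv, Matrix.mul_assoc, Matrix.smul_mul, Matrix.smul_mul, Matrix.mul_smul, Matrix.mul_smul,
      Matrix.mul_smul, h1, h2, smul_smul, smul_smul]
    have : S.ρ * S.σ₁ ^ 2 * (S.σ₁ ^ 2)⁻¹ * (S.ρ * S.σ₁ ^ 2) = S.ρ ^ 2 * S.σ₁ ^ 2 := by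
      field_simp
    rw [this]; abel
  rw [V, hR12, hR21, hR22, Matrix.det_fromBlocks₁₁, hschur]
  exact hA.mul hB

/-- The kriging mean is affine in `β₁` with slope `k₁`. -/
lemma krigingMean_eq (x : S.Q) (β : Fin p₁ → ℝ) (z : Fin n₁ ⊕ Fin n₂ → ℝ) :
    S.krigingMean x β z = S.k₁ x ⬝ᵥ β +
      ((fun j => S.k x (Sum.inr j)) ⬝ᵥ S.β₂ + S.t x ⬝ᵥ (S.V⁻¹ *ᵥ z)) := by
  have h1 : S.k x ⬝ᵥ Sum.elim β S.β₂ =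
      S.k₁ x ⬝ᵥ β + (fun j => S.k x (Sum.inr j)) ⬝ᵥ S.β₂ := by
    simp [dotProduct, k₁]
  rw [← add_assoc, ← h1, krigingMean, k, sub_dotProduct, Matrix.mulVec_sub, dotProduct_sub,
    ← Matrix.dotProduct_mulVec, Matrix.mulVec_mulVec]
  ring

lemma measurable_krigingMean (x : S.Q) :
    Measurable fun p : EuclideanSpace ℝ (Fin p₁) × (Fin n₁ ⊕ Fin n₂ → ℝ) =>
      S.krigingMean x p.1.ofLp p.2 := by
  simp only [krigingMean_eq, dotProduct]
  fun_prop

lemma measurable_postMean (π : Prior p₁) : Measurable (S.postMean π) := by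
  unfold postMean
  cases π <;> simp only [ν] <;> fun_prop

lemma measurable_predMean (π : Prior p₁) (x : S.Q) : Measurable (S.predMean π x) := by
  have h : Measurable fun z : Fin n₁ ⊕ Fin n₂ → ℝ =>
      ((WithLp.toLp 2 (S.postMean π z) : EuclideanSpace ℝ (Fin p₁)), z) := by
    have := S.measurable_postMean π
    fun_prop
  exact (S.measurable_krigingMean x).comp h

instance sFinite_priorMeasure (π : Prior p₁) : SFinite (S.priorMeasure π) := by
  cases π <;> simp only [priorMeasure] <;> infer_instance

/-! ### Moments and joint Gaussianity in the two-level model. -/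

section Model

variable {S} {Ω : Type*} [MeasurableSpace Ω] {Z₁ δ : S.Q → Ω → ℝ}
  {P : Kernel (EuclideanSpace ℝ (Fin p₁)) Ω}

lemma IsModel.measurable_Z₂ (h : S.IsModel Z₁ δ P) (x : S.Q) : Measurable (S.Z₂ Z₁ δ x) :=
  ((h.measurable_Z₁ x).const_mul _).add (h.measurable_δ x)

lemma IsModel.measurable_obs (h : S.IsModel Z₁ δ P) : Measurable (S.obs Z₁ δ) := by
  refine measurable_pi_iff.2 ?_
  rintro (i | i)
  · exact h.measurable_Z₁ _
  · exact h.measurable_Z₂ _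

lemma IsModel.memLp_Z₁ (h : S.IsModel Z₁ δ P) (β : EuclideanSpace ℝ (Fin p₁)) (x : S.Q) :
    MemLp (Z₁ x) 2 (P β) := ((h.gaussian_Z₁ β).hasGaussianLaw_eval x).memLp_two

lemma IsModel.memLp_δ (h : S.IsModel Z₁ δ P) (β : EuclideanSpace ℝ (Fin p₁)) (x : S.Q) :
    MemLp (δ x) 2 (P β) := ((h.gaussian_δ β).hasGaussianLaw_eval x).memLp_two

lemma IsModel.cov_Z₁_δ (h : S.IsModel Z₁ δ P) (β : EuclideanSpace ℝ (Fin p₁)) (x y : S.Q) :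
    cov[Z₁ x, δ y; P β] = 0 :=
  ((h.indep β).comp (measurable_pi_apply x) (measurable_pi_apply y)).covariance_eq_zero
    (h.memLp_Z₁ β x) (h.memLp_δ β y)

lemma IsModel.cov_Z₂_Z₁ [IsMarkovKernel P] (h : S.IsModel Z₁ δ P) (β : EuclideanSpace ℝ (Fin p₁)) (x y : S.Q) :
    cov[S.Z₂ Z₁ δ x, Z₁ y; P β] =
      S.ρ * S.σ₁ ^ 2 * S.r₁ ((x : EuclideanSpace ℝ (Fin d)) - y) := by
  have h2 : S.Z₂ Z₁ δ x = S.ρ • Z₁ x + δ x := rfl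
  rw [h2, covariance_add_left ((h.memLp_Z₁ β x).const_smul _) (h.memLp_δ β x) (h.memLp_Z₁ β y),
    covariance_smul_left, covariance_comm (δ x), h.cov_Z₁_δ, h.cov_Z₁]
  ring

lemma IsModel.cov_Z₂_Z₂ [IsMarkovKernel P] (h : S.IsModel Z₁ δ P) (β : EuclideanSpace ℝ (Fin p₁)) (x y : S.Q) :
    cov[S.Z₂ Z₁ δ x, S.Z₂ Z₁ δ y; P β] =
      S.ρ ^ 2 * S.σ₁ ^ 2 * S.r₁ ((x : EuclideanSpace ℝ (Fin d)) - y)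
        + S.σ₂ ^ 2 * S.r₂ ((x : EuclideanSpace ℝ (Fin d)) - y) := by
  have h2 (x : S.Q) : S.Z₂ Z₁ δ x = S.ρ • Z₁ x + δ x := rfl
  have hm (x : S.Q) := (h.memLp_Z₁ β x).const_smul S.ρ
  rw [h2, h2, covariance_add_left (hm x) (h.memLp_δ β x) ((hm y).add (h.memLp_δ β y)),
    covariance_add_right (hm x) (hm y) (h.memLp_δ β y),
    covariance_add_right (h.memLp_δ β x) (hm y) (h.memLp_δ β y),
    covariance_smul_left, covariance_smul_left, covariance_smul_right, covariance_smul_right,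
    covariance_comm (δ x) (Z₁ y), h.cov_Z₁_δ, h.cov_Z₁_δ, h.cov_Z₁, h.cov_δ]
  ring

lemma IsModel.integral_Z₂ [IsMarkovKernel P] (h : S.IsModel Z₁ δ P) (β : EuclideanSpace ℝ (Fin p₁)) (x : S.Q) :
    ∫ ω, S.Z₂ Z₁ δ x ω ∂(P β) = S.h x ⬝ᵥ Sum.elim β.ofLp S.β₂ := by
  simp only [Z₂]
  rw [integral_add (((h.memLp_Z₁ β x).integrable (by norm_num)).const_mul _)
    ((h.memLp_δ β x).integrable (by norm_num)), integral_const_mul, h.mean_Z₁, h.mean_δ]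
  simp [Setup.h, dotProduct, Finset.mul_sum, mul_assoc]

lemma IsModel.integral_obs [IsMarkovKernel P] (h : S.IsModel Z₁ δ P) (β : EuclideanSpace ℝ (Fin p₁))
    (i : Fin n₁ ⊕ Fin n₂) :
    ∫ ω, S.obs Z₁ δ ω i ∂(P β) = (S.H *ᵥ Sum.elim β.ofLp S.β₂) i := by
  rcases i with i | i
  · simp only [obs, Sum.elim_inl, h.mean_Z₁]
    simp [H, F₁, designMatrix, mulVec, dotProduct]
  · simp only [obs, Sum.elim_inr, h.integral_Z₂]
    simp [H, designMatrix, mulVec, Setup.h, dotProduct]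

lemma IsModel.cov_obs [IsMarkovKernel P] (h : S.IsModel Z₁ δ P) (β : EuclideanSpace ℝ (Fin p₁))
    (i j : Fin n₁ ⊕ Fin n₂) :
    cov[fun ω => S.obs Z₁ δ ω i, fun ω => S.obs Z₁ δ ω j; P β] = S.V i j := by
  rcases i with i | i <;> rcases j with j | j
  · exact (h.cov_Z₁ β _ _).trans (by simp [V, R₁, corrMatrix])
  · refine (covariance_comm _ _).trans ((h.cov_Z₂_Z₁ β _ _).trans ?_)
    -- Evenness of `r₁` is not part of the setup; at the differences needed it follows from symmetry
    -- of the covariance and `σ₁² ≠ 0`.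
    have h1 := (h.cov_Z₁ β (S.D₁ i) (S.D₂ j)).symm.trans
      ((covariance_comm _ _).trans (h.cov_Z₁ β (S.D₂ j) (S.D₁ i)))
    have h2 := mul_left_cancel₀ S.sigma₁_sq_ne_zero h1
    simp [V, corrMatrix, h2]
  · exact (h.cov_Z₂_Z₁ β _ _).trans (by simp [V, corrMatrix])
  · exact (h.cov_Z₂_Z₂ β _ _).trans (by simp [V, R₂, corrMatrix])

lemma IsModel.cov_Z₂_obs [IsMarkovKernel P] (h : S.IsModel Z₁ δ P) (β : EuclideanSpace ℝ (Fin p₁)) (x : S.Q)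
    (i : Fin n₁ ⊕ Fin n₂) :
    cov[S.Z₂ Z₁ δ x, fun ω => S.obs Z₁ δ ω i; P β] = S.t x i := by
  rcases i with i | i
  · exact h.cov_Z₂_Z₁ β _ _
  · exact h.cov_Z₂_Z₂ β _ _

/-- Restricted to the finite set of design points and `x`, the two processes are independent
Gaussian vectors, hence jointly Gaussian; the data together with `Z₂ x` are a linear image of the
pair. -/
lemma IsModel.hasGaussianLaw_obs_Z₂ (h : S.IsModel Z₁ δ P) (β : EuclideanSpace ℝ (Fin p₁))
    (x : S.Q) :
    HasGaussianLaw (fun ω => Sum.elim (S.obs Z₁ δ ω) (fun _ : Unit => S.Z₂ Z₁ δ x ω)) (P β) := by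
  classical
  let I : Finset S.Q := insert x (Finset.univ.image S.D₁ ∪ Finset.univ.image S.D₂)
  have hx : x ∈ I := by simp [I]
  have h1 (i) : S.D₁ i ∈ I := by simp [I]
  have h2 (i) : S.D₂ i ∈ I := by simp [I]
  have hI : Measurable (I.restrict : (S.Q → ℝ) → I → ℝ) := Finset.measurable_restrict I
  have hj := ((h.indep β).comp hI hI).hasGaussianLaw ((h.gaussian_Z₁ β).hasGaussianLaw I)
    ((h.gaussian_δ β).hasGaussianLaw I)
  let L : ((I → ℝ) × (I → ℝ)) →ₗ[ℝ] ((Fin n₁ ⊕ Fin n₂) ⊕ Unit → ℝ) :=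
    { toFun := fun p => Sum.elim
        (Sum.elim (fun i => p.1 ⟨S.D₁ i, h1 i⟩)
          (fun i => S.ρ * p.1 ⟨S.D₂ i, h2 i⟩ + p.2 ⟨S.D₂ i, h2 i⟩))
        (fun _ => S.ρ * p.1 ⟨x, hx⟩ + p.2 ⟨x, hx⟩)
      map_add' := by intro p q; ext ((i | i) | i) <;> simp <;> ring
      map_smul' := by intro r p; ext ((i | i) | i) <;> simp <;> ring }
  exact hasGaussianLaw_linearMap hj L

lemma IsModel.hasGaussianLaw_obs (h : S.IsModel Z₁ δ P) (β : EuclideanSpace ℝ (Fin p₁))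
    (x : S.Q) : HasGaussianLaw (S.obs Z₁ δ) (P β) :=
  hasGaussianLaw_linearMap (h.hasGaussianLaw_obs_Z₂ β x)
    (LinearMap.funLeft ℝ ℝ (Sum.inl : Fin n₁ ⊕ Fin n₂ → (Fin n₁ ⊕ Fin n₂) ⊕ Unit))

/-- Positivity is not assumed of `r₁`: it comes from the model, at the arbitrary parameter value
`0`, since the covariances do not depend on `β₁`. -/
lemma IsModel.posSemidef_R₁ [IsMarkovKernel P] (h : S.IsModel Z₁ δ P) : S.R₁.PosSemidef := by
  have h1 : (S.σ₁ ^ 2 • S.R₁).PosSemidef :=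
    posSemidef_of_covariance (P := P 0) (X := fun ω i => Z₁ (S.D₁ i) ω)
      (fun i => h.memLp_Z₁ 0 (S.D₁ i)) (fun i j => by simp [h.cov_Z₁, R₁, corrMatrix])
  have h2 := h1.smul (inv_nonneg.2 (sq_nonneg S.σ₁))
  rwa [smul_smul, inv_mul_cancel₀ S.sigma₁_sq_ne_zero, one_smul] at h2

lemma IsModel.posSemidef_V [IsMarkovKernel P] (h : S.IsModel Z₁ δ P) : S.V.PosSemidef := by
  refine posSemidef_of_covariance (P := P 0) ?_ (h.cov_obs 0)
  rintro (i | i)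
  · exact h.memLp_Z₁ 0 _
  · exact ((h.memLp_Z₁ 0 _).const_mul S.ρ).add (h.memLp_δ 0 _)

end Model

end Setup

end CoKriging

namespace CoKriging

/-! ### Posterior, kriging and predictive laws. -/

namespace Setup

variable {d n₁ n₂ p₁ p₂ : ℕ} {S : Setup d n₁ n₂ p₁ p₂} {Ω : Type*} [MeasurableSpace Ω]
  {Z₁ δ : S.Q → Ω → ℝ} {P : Kernel (EuclideanSpace ℝ (Fin p₁)) Ω} [IsMarkovKernel P]

lemma IsModel.posSemidef_score (h : S.IsModel Z₁ δ P) :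
    (S.F₁ᵀ * ((S.σ₁ ^ 2)⁻¹ • S.R₁⁻¹) * S.F₁).PosSemidef :=
  (h.posSemidef_R₁.inv.smul (inv_nonneg.2 (sq_nonneg S.σ₁))).conjTranspose_mul_mul_same S.F₁

lemma priorPrecision_mul (v : Fin p₁ → ℝ) (hv : ∀ i, 0 < v i) :
    ((S.σ₁ ^ 2)⁻¹ • (Matrix.diagonal v)⁻¹) * (S.σ₁ ^ 2 • Matrix.diagonal v) = 1 := by
  have hd : IsUnit (Matrix.diagonal v).det := by
    rw [Matrix.det_diagonal]
    exact IsUnit.mk0 _ (Finset.prod_ne_zero_iff.2 fun i _ => (hv i).ne')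
  rw [Matrix.smul_mul, Matrix.mul_smul, smul_smul, inv_mul_cancel₀ S.sigma₁_sq_ne_zero, one_smul,
    Matrix.nonsing_inv_mul _ hd]

lemma posDef_smul_diagonal (v : Fin p₁ → ℝ) (hv : ∀ i, 0 < v i) :
    (S.σ₁ ^ 2 • Matrix.diagonal v).PosDef :=
  (Matrix.PosDef.diagonal hv).smul (pow_pos S.σ₁_pos 2)

/-- The score information `F₁ᵀ R₁⁻¹ F₁ / σ₁²` is positive semidefinite. It becomes definite by
adding the prior precision in the one case, by being invertible in the other. -/
lemma IsModel.posDef_A (h : S.IsModel Z₁ δ P) (π : Prior p₁)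
    (hF₁ : π = Prior.nonInformative → IsUnit (S.F₁ᵀ * S.R₁⁻¹ * S.F₁).det) : (S.A π).PosDef := by
  cases π with
  | informative b v hv =>
    refine (Matrix.PosDef.posSemidef_add h.posSemidef_score ?_).inv
    exact (Matrix.PosDef.diagonal hv).inv.smul (inv_pos.2 (pow_pos S.σ₁_pos 2))
  | nonInformative =>
    refine (h.posSemidef_score.posDef_iff_isUnit.2 ?_).inv
    rw [Matrix.isUnit_iff_isUnit_det, Matrix.mul_smul, Matrix.smul_mul, Matrix.det_smul]
    exact (IsUnit.mk0 _ (pow_ne_zero _ (inv_ne_zero S.sigma₁_sq_ne_zero))).mul (hF₁ rfl)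

/-- Conditional law of `Z₂ x` given the data, for known `β₁`. -/
theorem IsModel.isCondLaw_Z₂ (h : S.IsModel Z₁ δ P) (hV : IsUnit S.V.det) (x : S.Q)
    (β : EuclideanSpace ℝ (Fin p₁)) :
    0 ≤ S.krigingVar x ∧ IsCondLaw (P β) (S.Z₂ Z₁ δ x) (S.obs Z₁ δ)
      (fun z => gaussianReal (S.krigingMean x β.ofLp z) (S.krigingVar x).toNNReal) := by
  have hvar : Var[S.Z₂ Z₁ δ x; P β] = S.ρ ^ 2 * S.σ₁ ^ 2 + S.σ₂ ^ 2 := by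
    rw [← covariance_self (h.measurable_Z₂ x).aemeasurable, h.cov_Z₂_Z₂, sub_self, S.r₁_zero,
      S.r₂_zero, mul_one, mul_one]
  exact isCondLaw_kriging h.measurable_obs (h.measurable_Z₂ x) (h.hasGaussianLaw_obs_Z₂ β x)
    (h.integral_obs β) (h.integral_Z₂ β x) (h.cov_obs β) (h.cov_Z₂_obs β x) hvar hV

/-- The posterior law of `β₁`. -/
theorem IsModel.isCondLaw_posterior (h : S.IsModel Z₁ δ P) (hR₁ : IsUnit S.R₁.det) (π : Prior p₁)
    (hF₁ : π = Prior.nonInformative → IsUnit (S.F₁ᵀ * S.R₁⁻¹ * S.F₁).det) (x : S.Q) :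
    IsCondLaw ((S.priorMeasure π) ⊗ₘ P) (fun q => q.1) (fun q => S.obs Z₁ δ q.2)
      (fun z => multivariateGaussian (WithLp.toLp 2 (S.postMean π z)) (S.A π)) := by
  have hnoise (β : EuclideanSpace ℝ (Fin p₁)) : (P β).map (S.obs Z₁ δ) =
      (noiseLaw S.V).map (fun e => (S.H₁ *ᵥ β.ofLp + S.offset) + e) := by
    refine map_eq_map_noiseLaw h.measurable_obs (h.hasGaussianLaw_obs β x) ?_ (h.cov_obs β)
    intro i
    rw [h.integral_obs, H_mulVec]
  have hg : Measurable fun z => (WithLp.toLp 2 (S.postMean π z) : EuclideanSpace ℝ (Fin p₁)) := by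
    have := S.measurable_postMean π
    fun_prop
  have hΦ : Measurable fun p : EuclideanSpace ℝ (Fin p₁) × (Fin n₁ ⊕ Fin n₂ → ℝ) =>
      (p.2, p.1 - WithLp.toLp 2 (S.postMean π p.2)) :=
    measurable_snd.prodMk (measurable_fst.sub (hg.comp measurable_snd))
  have hG := S.scoreMatrix_mul_V hR₁
  have hmap := map_compProd_eq_map_prod (π := S.priorMeasure π) h.measurable_obs
    (a := fun β => S.H₁ *ᵥ β.ofLp + S.offset) (by fun_prop) hnoise hΦ
  -- `A` is defined as a matrix inverse; its invertibility is transferred back to the bracketed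
  -- matrix, so that their product really is `1`.
  have hA := (h.posDef_A π hF₁).isUnit
  obtain ⟨l, hl, heq⟩ : ∃ l : Measure (Fin n₁ ⊕ Fin n₂ → ℝ), SigmaFinite l ∧
      ((S.priorMeasure π) ⊗ₘ P).map (fun q => (S.obs Z₁ δ q.2,
        q.1 - WithLp.toLp 2 (S.postMean π (S.obs Z₁ δ q.2)))) =
      l.prod (multivariateGaussian 0 (S.A π)) := by
    cases π with
    | informative b v hv =>
      have hA1 : S.A (Prior.informative b v hv) * (S.scoreMatrix * S.H₁ +
          (S.σ₁ ^ 2)⁻¹ • (Matrix.diagonal v)⁻¹) = 1 := by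
        rw [scoreMatrix_mul_H₁]
        exact Matrix.nonsing_inv_mul _
          ((Matrix.isUnit_iff_isUnit_det _).1 (Matrix.isUnit_nonsing_inv_iff.1 hA))
      have hpost (z : Fin n₁ ⊕ Fin n₂ → ℝ) : S.postMean (Prior.informative b v hv) z =
          S.A (Prior.informative b v hv) *ᵥ (S.scoreMatrix *ᵥ (z - S.offset) +
            ((S.σ₁ ^ 2)⁻¹ • (Matrix.diagonal v)⁻¹) *ᵥ b) := by
        rw [scoreMatrix_mulVec_sub_offset, scoreMatrix_mulVec]; rfl
      have hres := map_residual_gaussian_prior h.posSemidef_V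
        (posDef_smul_diagonal v hv).posSemidef hG (priorPrecision_mul v hv) hA1 b S.offset
      have hYm : Measurable fun p : EuclideanSpace ℝ (Fin p₁) × (Fin n₁ ⊕ Fin n₂ → ℝ) =>
          S.H₁ *ᵥ p.1.ofLp + S.offset + p.2 := by fun_prop
      have := Measure.isProbabilityMeasure_map (μ := (multivariateGaussian (WithLp.toLp 2 b)
        (S.σ₁ ^ 2 • Matrix.diagonal v)).prod (noiseLaw S.V)) hYm.aemeasurable
      simp only [← hpost] at hres
      exact ⟨_, inferInstance, hmap.trans hres⟩
    | nonInformative =>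
      have hA1 : S.A Prior.nonInformative * (S.scoreMatrix * S.H₁) = 1 := by
        rw [scoreMatrix_mul_H₁]
        exact Matrix.nonsing_inv_mul _
          ((Matrix.isUnit_iff_isUnit_det _).1 (Matrix.isUnit_nonsing_inv_iff.1 hA))
      have hpost (z : Fin n₁ ⊕ Fin n₂ → ℝ) : S.postMean Prior.nonInformative z =
          S.A Prior.nonInformative *ᵥ (S.scoreMatrix *ᵥ (z - S.offset)) := by
        rw [scoreMatrix_mulVec_sub_offset, scoreMatrix_mulVec]; rfl
      obtain ⟨l, hl, hres⟩ := map_residual_flat_prior h.posSemidef_V hG hA1 S.offset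
      simp only [← hpost] at hres
      exact ⟨l, hl, hmap.trans hres⟩
  have := isCondLaw_of_map_residual_eq_prod measurable_fst
    (h.measurable_obs.comp measurable_snd) hg l (multivariateGaussian 0 (S.A π)) heq
  simp only [multivariateGaussian_map_const_add] at this
  exact this

/-- Integrating the kriging law over the posterior of `β₁`. -/
theorem IsModel.bind_krigingLaw (h : S.IsModel Z₁ δ P) (π : Prior p₁)
    (hF₁ : π = Prior.nonInformative → IsUnit (S.F₁ᵀ * S.R₁⁻¹ * S.F₁).det) (x : S.Q)
    (hs : 0 ≤ S.krigingVar x) (z : Fin n₁ ⊕ Fin n₂ → ℝ) :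
    (multivariateGaussian (WithLp.toLp 2 (S.postMean π z)) (S.A π)).bind
        (fun β₁ => gaussianReal (S.krigingMean x β₁.ofLp z) (S.krigingVar x).toNNReal) =
      gaussianReal (S.predMean π x z) (S.predVar π x).toNNReal := by
  have hA := (h.posDef_A π hF₁).posSemidef
  have h0 : 0 ≤ S.k₁ x ⬝ᵥ (S.A π *ᵥ S.k₁ x) := by
    simpa using hA.dotProduct_mulVec_nonneg (S.k₁ x)
  -- `Real.toNNReal` truncates at `0`, so splitting the variance requires both summands to be
  -- nonnegative.
  rw [predMean, predVar, Real.toNNReal_add hs h0, add_comm]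
  simp only [krigingMean_eq]
  exact multivariateGaussian_bind_gaussianReal _ hA _ _ _

lemma IsModel.predVar_nonneg (h : S.IsModel Z₁ δ P) (π : Prior p₁)
    (hF₁ : π = Prior.nonInformative → IsUnit (S.F₁ᵀ * S.R₁⁻¹ * S.F₁).det) (x : S.Q)
    (hs : 0 ≤ S.krigingVar x) : 0 ≤ S.predVar π x :=
  add_nonneg hs (by simpa using (h.posDef_A π hF₁).posSemidef.dotProduct_mulVec_nonneg (S.k₁ x))

/-- The predictive law of `Z₂ x`. -/
theorem IsModel.isCondLaw_pred (h : S.IsModel Z₁ δ P) (hR₁ : IsUnit S.R₁.det)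
    (hV : IsUnit S.V.det) (π : Prior p₁)
    (hF₁ : π = Prior.nonInformative → IsUnit (S.F₁ᵀ * S.R₁⁻¹ * S.F₁).det) (x : S.Q) :
    IsCondLaw ((S.priorMeasure π) ⊗ₘ P) (fun q => S.Z₂ Z₁ δ x q.2) (fun q => S.obs Z₁ δ q.2)
      (fun z => gaussianReal (S.predMean π x z) (S.predVar π x).toNNReal) := by
  have hm := S.measurable_krigingMean x
  have hp := S.measurable_predMean π x
  have := isMarkovKernel_translationKernel (gaussianReal 0 (S.krigingVar x).toNNReal) hm
  have := isMarkovKernel_translationKernel (gaussianReal 0 (S.predVar π x).toNNReal) hp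
  -- The tower property needs a kernel jointly measurable in `(β₁, z)`; translating a centred
  -- Gaussian by the jointly measurable kriging mean provides one.
  refine isCondLaw_predictive (h.measurable_Z₂ x) h.measurable_obs
    (translationKernel (gaussianReal 0 (S.krigingVar x).toNNReal)
      (fun p : EuclideanSpace ℝ (Fin p₁) × (Fin n₁ ⊕ Fin n₂ → ℝ) => S.krigingMean x p.1.ofLp p.2))
    (translationKernel (gaussianReal 0 (S.predVar π x).toNNReal) (S.predMean π x))
    (fun z => ?_) (h.isCondLaw_posterior hR₁ π hF₁ x) (fun β => ?_) (fun z => ?_)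
  · rw [translationKernel_apply _ hp, gaussianReal_map_const_add, zero_add]
  · simp only [translationKernel_apply _ hm, gaussianReal_map_const_add, zero_add]
    exact (h.isCondLaw_Z₂ hV x β).2
  · simp only [translationKernel_apply _ hm, gaussianReal_map_const_add, zero_add]
    exact h.bind_krigingLaw π hF₁ x (h.isCondLaw_Z₂ hV x 0).1 z

end Setup

end CoKriging

theorem mainTheorem6 {d n₁ n₂ p₁ p₂ : ℕ} (S : CoKriging.Setup d n₁ n₂ p₁ p₂)
    {Ω : Type*} [MeasurableSpace Ω] (Z₁ δ : S.Q → Ω → ℝ)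
    (P : Kernel (EuclideanSpace ℝ (Fin p₁)) Ω) [IsMarkovKernel P]
    (hmodel : S.IsModel Z₁ δ P)
    (hR₁ : IsUnit S.R₁.det) (hR₂ : IsUnit S.R₂.det)
    (π : CoKriging.Prior p₁)
    (hF₁ : π = CoKriging.Prior.nonInformative → IsUnit (S.F₁ᵀ * S.R₁⁻¹ * S.F₁).det)
    (x : S.Q) :
    -- the parameters of the Gaussian laws below are admissible
    IsUnit S.V.det ∧ (S.A π).PosDef ∧ 0 ≤ S.krigingVar x ∧ 0 ≤ S.predVar π x ∧
    -- posterior law of `β₁` given the data, in the joint model of `(β₁, ω)`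
    CoKriging.IsCondLaw ((S.priorMeasure π) ⊗ₘ P)
      (fun q => q.1) (fun q => S.obs Z₁ δ q.2)
      (fun z => multivariateGaussian (WithLp.toLp 2 (S.postMean π z)) (S.A π)) ∧
    -- law of `Z₂(x)` given the data and `β₁`
    (∀ β₁ : EuclideanSpace ℝ (Fin p₁),
      CoKriging.IsCondLaw (P β₁) (S.Z₂ Z₁ δ x) (S.obs Z₁ δ)
        (fun z => gaussianReal (S.krigingMean x β₁.ofLp z) (S.krigingVar x).toNNReal)) ∧
    -- integrating `β₁` out of the latter over its posterior
    (∀ z : Fin n₁ ⊕ Fin n₂ → ℝ,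
      (multivariateGaussian (WithLp.toLp 2 (S.postMean π z)) (S.A π)).bind
          (fun β₁ => gaussianReal (S.krigingMean x β₁.ofLp z) (S.krigingVar x).toNNReal) =
        gaussianReal (S.predMean π x z) (S.predVar π x).toNNReal) ∧
    -- predictive law: `Z₂(x)` given the data, in the joint model of `(β₁, ω)`
    CoKriging.IsCondLaw ((S.priorMeasure π) ⊗ₘ P)
      (fun q => S.Z₂ Z₁ δ x q.2) (fun q => S.obs Z₁ δ q.2)
      (fun z => gaussianReal (S.predMean π x z) (S.predVar π x).toNNReal) := by
  have hV := S.isUnit_det_V hR₁ hR₂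
  -- The kriging variance does not involve `β₁`, so any parameter value serves here.
  have hs := (hmodel.isCondLaw_Z₂ hV x 0).1
  exact ⟨hV, hmodel.posDef_A π hF₁, hs, hmodel.predVar_nonneg π hF₁ x hs,
    hmodel.isCondLaw_posterior hR₁ π hF₁ x, fun β => (hmodel.isCondLaw_Z₂ hV x β).2,
    hmodel.bind_krigingLaw π hF₁ x hs, hmodel.isCondLaw_pred hR₁ hV π hF₁ x⟩
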